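/- **Setting (single-label bandit multiclass classification).** Let $\mathcal X$ be a measurable space, $\mathcal Y=[K]$, let $\mathcal D$ be a probability distribution on $\mathcal X\times\mathcal Y$, and let $\mathcal H$ be a finite nonempty class of measurable functions $h:\mathcal X\to\mathcal Y$. Write $r_{\mathcal D}(h)=\mathbb E_{(x,y)\sim\mathcal D}[\mathbf 1\{h(x)=y\}]$ and let $h^\star\in\arg\max_{h\in\mathcal H}r_{\mathcal D}(h)$. In each round a fresh pair $(x_i,y_i)\sim\mathcal D$ is drawn independently, the learner sees $x_i$, predicts a label $\hat y_i$, and observes only $\mathbf 1\{\hat y_i=y_i\}$. An ERM oracle $\mathsf{ERM}_{\mathcal H}$ maps every finite sequence of pairs $(x_i,\hat r_i)\in\mathcal X\times\mathbb R_+^K$ to some $h\in\mathcal H$ maximizing $\sum_i\hat r_i(h(x_i))$, with any (measurable) tie-breaking. For $p$ in the simplex $\Delta_{\mathcal H}$ of probability distributions on $\mathcal H$ and $\gamma\in(0,1)$ put $p_\gamma(x,y)=(1-\gamma)\sum_{h\in\mathcal H}p(h)\mathbf 1\{h(x)=y\}+\gamma/K$. **Algorithm** (parameters $N_1,N_2,T\in\mathbb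 N$ and $\gamma\in(0,\tfrac12]$). *Phase 1.* For $N_1$ rounds, predict $\hat y_i\in\mathcal Y$ uniformly at random, and let $S$ be the sequence (with repetitions) of the pairs $(x_i,y_i)$ of those rounds in which $\hat y_i=y_i$. Let $p_1\in\Delta_{\mathcal H}$ be a delta distribution on an arbitrary hypothesis. For $t=1,\dots,T$, let $h_t$ be the output of $\mathsf{ERM}_{\mathcal H}$ on the pairs $(x_i,\hat r_i)$, $(x_i,y_i)\in S$, with $$\hat r_i(y)=\frac1{|S|}(1-\gamma)\frac{\mathbf 1\{y_i=y\}}{(p_t)_\gamma(x_i,y)},$$ and set $p_{t+1}=(1-\eta_t)p_t+\eta_t\,\delta_{h_t}$ with $\eta_t=2/(2+t)$. Put $\hat p=p_{T+1}$. *Phase 2.* For $N_2$ further rounds, with probability $\gamma$ predict $\hat y_i$ uniformly at random, and otherwise sample $h_i\sim\hat p$ and predict $\hat y_i=h_i(x_i)$. Return $h_{\mathrm{out}}$, the output of $\mathsf{ERM}_{\mathcal H}$ on the $N_2$ pairs $(x_i,\hat r_i)$ of this phase with $\hat r_i(y)=\mathbf 1\{\hat y_i=y_i=y\}/\hat p_\gamma(x_i,y)$.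 **Theorem.** There are absolute constants $c_1,c_2,c_3>0$ such that the following holds for all $\mathcal X$, $K$, $\mathcal D$, $\mathcal H$, all ERM oracles and initial hypotheses as above, all $\varepsilon>0$, all $\delta\in(0,1)$, and all $N_1,N_2,T\in\mathbb N$ with $$N_1\ge c_1K^7\log\frac{|\mathcal H|}\delta,\qquad N_2\ge c_2\Big(\frac K\varepsilon+\frac1{\varepsilon^2}\Big)\log\frac{|\mathcal H|}\delta,\qquad T\ge c_3K^4 .$$ Run with $\gamma=\tfrac12$ and these parameters, the algorithm returns, with probability at least $1-\delta$ over all the randomness of the interaction, a hypothesis $h_{\mathrm{out}}\in\mathcal H$ with $r_{\mathcal D}(h^\star)-r_{\mathcal D}(h_{\mathrm{out}})\le\varepsilon$, and it always makes exactly $T+1$ calls to $\mathsf{ERM}_{\mathcal H}$. If moreover $N_1$, $N_2$ and $T$ are of the stated orders, that is, at most constants $C_1,C_2,C_3$ times $K^7\log(|\mathcal H|/\delta)$, $(K/\varepsilon+1/\varepsilon^2)\log(|\mathcal H|/\delta)$ and $K^4$ respectively, then the number of samples satisfies $$N_1+N_2=O\Big(\Big(K^7+\frac1{\varepsilon^2}\Big)\log\frac{|\mathcal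 H|}\delta\Big)$$ and the number of ERM calls satisfies $T+1=O(K^4)$, with implied constants depending only on $C_1,C_2,C_3$ (and $c_1,c_2,c_3$). -/

import Mathlib

open MeasureTheory ProbabilityTheory

namespace BanditPAC

/-- The population reward `r_D(h) = E_{(x,y) ∼ D} [𝟙{h(x) = y}]` of a hypothesis. -/
noncomputable def reward {X : Type*} [MeasurableSpace X] {K : ℕ}
    (D : Measure (X × Fin K)) (h : X → Fin K) : ℝ :=
  ∫ z, (if h z.1 = z.2 then (1 : ℝ) else 0) ∂D

/-- `h` is `ε`-optimal in the class `H`: `r_D(h') - r_D(h) ≤ ε` for every `h' ∈ H`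
(equivalently, for a best hypothesis of the finite class `H`). -/
def EpsOptimal {X : Type*} [MeasurableSpace X] {K : ℕ}
    (D : Measure (X × Fin K)) (H : Finset (X → Fin K)) (ε : ℝ) (h : X → Fin K) : Prop :=
  ∀ h' ∈ H, reward D h' - reward D h ≤ ε

/-- An empirical risk minimization oracle for the class `H`. On a finite sequence of pairs
`(xᵢ, r̂ᵢ)` with nonnegative reward vectors `r̂ᵢ` it returns a member `h` of `H` that maximizes
`∑ᵢ r̂ᵢ(h(xᵢ))`; ties are broken in any (measurable) way. -/
structure ERMOracle {X : Type*} [MeasurableSpace X] {K : ℕ} (H : Finset (X → Fin K)) where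
  /-- the hypothesis returned on a data sequence -/
  run : List (X × (Fin K → ℝ)) → H
  isMax : ∀ S : List (X × (Fin K → ℝ)), (∀ d ∈ S, ∀ y, 0 ≤ d.2 y) →
    ∀ h ∈ H, (S.map fun d => d.2 (h d.1)).sum ≤ (S.map fun d => d.2 ((run S).1 d.1)).sum
  measurable : ∀ (n : ℕ) (h : H),
    MeasurableSet {S : Fin n → X × (Fin K → ℝ) | run (List.ofFn S) = h}

/-- The result of a computation together with the number of oracle calls that it made. -/
structure Counted (α : Type*) where
  /-- the result -/
  val : α
  /-- the number of oracle calls -/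
  calls : ℕ

instance : Monad Counted where
  pure a := ⟨a, 0⟩
  bind c f := ⟨(f c.val).val, c.calls + (f c.val).calls⟩

/-- One call to the oracle. -/
def ERMOracle.call {X : Type*} [MeasurableSpace X] {K : ℕ} {H : Finset (X → Fin K)}
    (E : ERMOracle H) (S : List (X × (Fin K → ℝ))) : Counted H :=
  ⟨E.run S, 1⟩

/-- One round of the interaction: the pair `(x, y)` generated by the environment and the
predicted label `ŷ`. -/
abbrev Round (X : Type*) (K : ℕ) := (X × Fin K) × Fin K

/-- What the learner sees of a round: the context, its own prediction and the bandit feedback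
`𝟙{ŷ = y}`. -/
abbrev Obs (X : Type*) (K : ℕ) := X × Fin K × Bool

/-- The observation that the learner makes in a round. -/
def observe {X : Type*} {K : ℕ} (w : Round X K) : Obs X K :=
  (w.1.1, w.2, decide (w.2 = w.1.2))

/-- `p_γ(x, y) = (1 - γ) ∑_h p(h) 𝟙{h(x) = y} + γ / K`: the probability of predicting `y` on `x`
when a hypothesis is sampled from `p`, mixed with the uniform distribution over the labels. -/
noncomputable def mixProb {X : Type*} {K : ℕ} {H : Finset (X → Fin K)}
    (γ : ℝ) (p : H → ℝ) (x : X) (y : Fin K) : ℝ :=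
  (1 - γ) * (∑ h : H, p h * (if h.1 x = y then 1 else 0)) + γ / K

open scoped Classical in
/-- The delta distribution on `h`, as a vector indexed by `H`. -/
noncomputable def delta {X : Type*} {K : ℕ} {H : Finset (X → Fin K)} (h : H) : H → ℝ :=
  Pi.single h 1

/-- The labeled sample `S` collected in the first phase: the pairs `(xᵢ, ŷᵢ)` of the rounds with
positive feedback (where `ŷᵢ = yᵢ`), in order and with repetitions. -/
def labeledSample {X : Type*} {K : ℕ} {n : ℕ} (o : Fin n → Obs X K) : List (X × Fin K) :=
  ((List.ofFn o).filter fun w => w.2.2).map fun w => (w.1, w.2.1)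

/-- The oracle input at the current iterate `p`: the pairs `(xᵢ, r̂ᵢ)`, for `(xᵢ, yᵢ)` in `S`, with
`r̂ᵢ(y) = (1 / |S|) (1 - γ) 𝟙{yᵢ = y} / p_γ(xᵢ, y)`. -/
noncomputable def phaseOneData {X : Type*} {K : ℕ} {H : Finset (X → Fin K)}
    (γ : ℝ) (p : H → ℝ) (S : List (X × Fin K)) : List (X × (Fin K → ℝ)) :=
  S.map fun d => (d.1, fun y =>
    1 / (S.length : ℝ) * (1 - γ) * ((if d.2 = y then 1 else 0) / mixProb γ p d.1 y))

/-- `frankWolfe E γ S h₀ t` is the iterate `p_{t+1}`, reached after `t` iterations from the delta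
distribution `p₁` on `h₀`. Iteration `t` makes one oracle call, with result `h_t`, and updates
`p_{t+1} = (1 - η_t) p_t + η_t δ_{h_t}` where `η_t = 2 / (2 + t)`. -/
noncomputable def frankWolfe {X : Type*} [MeasurableSpace X] {K : ℕ} {H : Finset (X → Fin K)}
    (E : ERMOracle H) (γ : ℝ) (S : List (X × Fin K)) (h₀ : H) : ℕ → Counted (H → ℝ)
  | 0 => pure (delta h₀)
  | t + 1 => do
    let p ← frankWolfe E γ S h₀ t
    let h ← E.call (phaseOneData γ p S)
    let η : ℝ := 2 / (2 + ((t + 1 : ℕ) : ℝ))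
    pure ((1 - η) • p + η • delta h)

/-- The computation at the end of the first phase: the distribution `p̂ = p_{T+1}` over `H`. -/
noncomputable def phaseOne {X : Type*} [MeasurableSpace X] {K : ℕ} {H : Finset (X → Fin K)}
    (E : ERMOracle H) (γ : ℝ) (h₀ : H) (T : ℕ) {N₁ : ℕ} (o : Fin N₁ → Obs X K) :
    Counted (H → ℝ) :=
  frankWolfe E γ (labeledSample o) h₀ T

/-- The oracle input at the end of the second phase: the pairs `(xᵢ, r̂ᵢ)` with
`r̂ᵢ(y) = 𝟙{ŷᵢ = yᵢ = y} / p_γ(xᵢ, y)`. -/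
noncomputable def phaseTwoData {X : Type*} {K : ℕ} {H : Finset (X → Fin K)}
    (γ : ℝ) (p : H → ℝ) {n : ℕ} (o : Fin n → Obs X K) : List (X × (Fin K → ℝ)) :=
  List.ofFn fun i => ((o i).1, fun y =>
    (if (o i).2.2 = true ∧ (o i).2.1 = y then 1 else 0) / mixProb γ p (o i).1 y)

/-- All the computations of the algorithm, from the observations of the `N₁ + N₂` rounds to the
returned hypothesis `h_out`, with the total number of oracle calls. -/
noncomputable def output {X : Type*} [MeasurableSpace X] {K : ℕ} {H : Finset (X → Fin K)}
    (E : ERMOracle H) (γ : ℝ) (h₀ : H) (T : ℕ) {N₁ N₂ : ℕ}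
    (o₁ : Fin N₁ → Obs X K) (o₂ : Fin N₂ → Obs X K) : Counted H := do
  let p ← phaseOne E γ h₀ T o₁
  E.call (phaseTwoData γ p o₂)

/-- The law of a round of the first phase: `(x, y) ∼ D` and, independently, a uniform label `ŷ`. -/
noncomputable def uniformRoundLaw {X : Type*} [MeasurableSpace X] {K : ℕ}
    (D : Measure (X × Fin K)) : Measure (Round X K) :=
  D.prod (uniformOn Set.univ)

/-- The law of a round of the second phase when `p̂ = p`: `(x, y) ∼ D` and, independently of it,
with probability `γ` the label `ŷ` is uniform, and otherwise `h ∼ p` is sampled and `ŷ = h(x)`. -/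
noncomputable def mixRoundLaw {X : Type*} [MeasurableSpace X] {K : ℕ} {H : Finset (X → Fin K)}
    (D : Measure (X × Fin K)) (γ : ℝ) (p : H → ℝ) : Measure (Round X K) :=
  ENNReal.ofReal γ • uniformRoundLaw D +
    ENNReal.ofReal (1 - γ) • ∑ h : H, ENNReal.ofReal (p h) • D.map fun z => (z, h.1 z.1)

/-- The joint law of the `N₁ + N₂` rounds: the first-phase rounds are i.i.d., and given them the
second-phase rounds are i.i.d. with the distribution `p̂` computed from the first-phase
observations. -/
noncomputable def interactionLaw {X : Type*} [MeasurableSpace X] {K : ℕ} {H : Finset (X → Fin K)}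
    (D : Measure (X × Fin K)) (E : ERMOracle H) (γ : ℝ) (h₀ : H) (N₁ N₂ T : ℕ) :
    Measure ((Fin N₁ → Round X K) × (Fin N₂ → Round X K)) :=
  (Measure.pi fun _ : Fin N₁ => uniformRoundLaw D).bind fun w₁ =>
    (Measure.pi fun _ : Fin N₂ =>
      mixRoundLaw D γ (phaseOne E γ h₀ T fun i => observe (w₁ i)).val).map (Prod.mk w₁)

/-- A run of the algorithm on the rounds `w`: the returned hypothesis and the number of oracle
calls, computed from the observations alone. -/
noncomputable def runOn {X : Type*} [MeasurableSpace X] {K : ℕ} {H : Finset (X → Fin K)}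
    (E : ERMOracle H) (γ : ℝ) (h₀ : H) (T : ℕ) {N₁ N₂ : ℕ}
    (w : (Fin N₁ → Round X K) × (Fin N₂ → Round X K)) : Counted H :=
  output E γ h₀ T (fun i => observe (w.1 i)) (fun i => observe (w.2 i))

end BanditPAC

open BanditPAC

/-!
Write `q_p(x, y)` for `p_γ(x, y)` at `γ = 1 / 2`; it lies in `[1 / (2K), 1]`. The whole argument
turns on the inverse reward `V_p(h) = E_D[𝟙{h(x) = y} / q_p(x, y)]` (`invReward`). It is the second
moment of the importance-weighted reward estimate of `h` in the second phase, so a distribution `p`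
with `V_p = O(1)` on all of `H` makes a Bernstein bound with constant variance and range `2K`
available there, which is where the sample size `K / ε + 1 / ε²` comes from
(`pi_real_sum_le_sum_onCorrect`).

Such a `p` is found by maximizing the concave function `∑_S log q_p(x, y)` over the simplex. At an
exact maximizer the first-order condition says that the empirical average of
`𝟙{h(x) = y} / q_p(x, y)` is at most `2` for every `h`. The oracle call of an iteration is the
linear maximization step of the Frank–Wolfe method for this function. Its curvature is `O(K²)`, so the
suboptimality after `T` steps is `O(K² / T)` per sample point (`sum_log_sub_le`), and a further step
of length of order `1 / K²` towards `h` shows that the first-order condition holds up to a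
constant as soon as `T` is of order `K⁴` (`sum_div_le_two_mul_card`).

The passage from the sample to the population has to be uniform over the simplex, because the
computed distribution depends on the sample. A distribution `p` is replaced by the empirical
distribution of `m = 2K³` hypotheses sampled from `p`: by Jensen's inequality this does not
decrease the expectation of `1 / q_p(x, y)`, and by a variance computation it increases it by at
most `1` (`sum_prod_mul_inv_mixProb`). Only `|H| ^ m` empirical distributions have to be controlled,
and for each of them a lower tail bound for nonnegative variables suffices
(`pi_real_sum_onCorrect_invHit_le`); averaging over the sampled tuple gives
`V_p(h) ≤ 52` for the computed `p` (`invReward_phaseOne_le`). All rounds of the first phase are used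
in these bounds, those without positive feedback contributing `0`, so that no conditioning on the
random size of `S` is needed.

The law of the interaction is a composition of measures along a kernel once the computed
distribution is known to depend measurably on the rounds. This holds because it takes finitely many
values, each on a set that is measurable by the measurability of the oracle's tie-breaking
(`frankWolfe_finite_range`).
-/

namespace BanditPAC

/-! ### The Frank–Wolfe iteration for the logarithmic barrier -/

/-- Quadratic lower bound for the logarithm along a segment inside `[c, 1]`. -/
lemma log_segment_lower {c q r e : ℝ} (hc : 0 < c) (hq : c ≤ q) (hq1 : q ≤ 1) (hr : c ≤ r)
    (hr1 : r ≤ 1) (he : 0 ≤ e) (he1 : e ≤ 1) :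
    Real.log q + e * (r / q - 1) - e ^ 2 * (1 / c ^ 2) ≤ Real.log ((1 - e) * q + e * r) := by
  set q' := (1 - e) * q + e * r with hq'
  have h1 : c ≤ q' := by nlinarith
  have hq0 : 0 < q := by linarith
  have hq'0 : 0 < q' := by linarith
  have h2 : 1 - (q' / q)⁻¹ ≤ Real.log (q' / q) := Real.one_sub_inv_le_log_of_pos (by positivity)
  rw [Real.log_div hq'0.ne' hq0.ne', inv_div] at h2
  have h3 : 1 - q / q' = e * (r / q - 1) - e ^ 2 * ((r - q) ^ 2 / (q * q')) := by
    field_simp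
    rw [hq']
    ring
  have h4 : (r - q) ^ 2 / (q * q') ≤ 1 / c ^ 2 := by
    apply div_le_div₀ (by norm_num) _ (by positivity)
    · nlinarith
    · nlinarith [abs_le.mpr (⟨by linarith, by linarith⟩ : -1 ≤ r - q ∧ r - q ≤ 1)]
  have h5 := mul_le_mul_of_nonneg_left h4 (sq_nonneg e)
  linarith

section Abstract

variable {ι η : Type*} [Fintype ι] [Fintype η]

/-- Summed form of `log_segment_lower`: one step from `q` towards the vertex `r`. -/
lemma sum_log_segment_lower {c e : ℝ} {q r : ι → ℝ} (hc : 0 < c)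
    (hq : ∀ i, c ≤ q i ∧ q i ≤ 1) (hr : ∀ i, c ≤ r i ∧ r i ≤ 1) (he : 0 ≤ e) (he1 : e ≤ 1) :
    ∑ i, Real.log (q i) + e * (∑ i, r i / q i - Fintype.card ι)
        - Fintype.card ι * (e ^ 2 * (1 / c ^ 2)) ≤
      ∑ i, Real.log ((1 - e) * q i + e * r i) := by
  have h := Finset.sum_le_sum fun i (_ : i ∈ Finset.univ) =>
    log_segment_lower hc (hq i).1 (hq i).2 (hr i).1 (hr i).2 he he1
  refine le_trans (le_of_eq ?_) h
  simp only [Finset.sum_sub_distrib, Finset.sum_add_distrib, ← Finset.mul_sum, Finset.sum_const,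
    Finset.card_univ, nsmul_eq_mul]
  ring

/-- Convergence of the Frank–Wolfe iteration with steps `2 / (t + 3)` for maximizing
`∑ᵢ log qᵢ` over the convex hull of the vectors `Q h`, whose entries lie in `[c, 1]`. -/
lemma sum_log_sub_le {c : ℝ} (hc : 0 < c) (hc1 : c ≤ 1) (Q : η → ι → ℝ)
    (hQ : ∀ h i, c ≤ Q h i ∧ Q h i ≤ 1) (q : ℕ → ι → ℝ) (s : ℕ → η)
    (hq : ∀ t i, c ≤ q t i ∧ q t i ≤ 1)
    (hmax : ∀ t h, ∑ i, Q h i / q t i ≤ ∑ i, Q (s t) i / q t i)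
    (hstep : ∀ t i, q (t + 1) i = (1 - 2 / ((t : ℝ) + 3)) * q t i + 2 / ((t : ℝ) + 3) * Q (s t) i)
    (p : η → ℝ) (hp : ∀ h, 0 ≤ p h) (hp1 : ∑ h, p h = 1) (t : ℕ) :
    ∑ i, Real.log (∑ h, p h * Q h i) - ∑ i, Real.log (q t i) ≤
      Fintype.card ι * (1 / c ^ 2) * (4 / ((t : ℝ) + 2)) := by
  set n : ℝ := ((Fintype.card ι : ℕ) : ℝ) with hn
  have hn0 : 0 ≤ n := by positivity
  set C : ℝ := 1 / c ^ 2 with hC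
  have hrc : ∀ i, c ≤ ∑ h, p h * Q h i := fun i => by
    calc c = ∑ h, p h * c := by rw [← Finset.sum_mul, hp1, one_mul]
      _ ≤ _ := Finset.sum_le_sum fun h _ => mul_le_mul_of_nonneg_left (hQ h i).1 (hp h)
  have hr1 : ∀ i, ∑ h, p h * Q h i ≤ 1 := fun i => by
    calc _ ≤ ∑ h, p h * 1 :=
          Finset.sum_le_sum fun h _ => mul_le_mul_of_nonneg_left (hQ h i).2 (hp h)
      _ = 1 := by rw [← Finset.sum_mul, hp1, one_mul]
  induction t with
  | zero =>
    have h1 : ∀ i, Real.log (∑ h, p h * Q h i) - Real.log (q 0 i) ≤ C * 2 := fun i => by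
      have a1 : Real.log (∑ h, p h * Q h i) ≤ 0 :=
        Real.log_nonpos (hc.le.trans (hrc i)) (hr1 i)
      have a2 : Real.log c ≤ Real.log (q 0 i) := Real.log_le_log hc (hq 0 i).1
      have a3 : 1 - c⁻¹ ≤ Real.log c := Real.one_sub_inv_le_log_of_pos hc
      have a4 : c⁻¹ ≤ C := by
        rw [hC, inv_eq_one_div]
        exact one_div_le_one_div_of_le (by positivity) (by nlinarith)
      have a5 : 0 < C := by positivity
      linarith
    rw [← Finset.sum_sub_distrib]
    refine (Finset.sum_le_sum fun i _ => h1 i).trans (le_of_eq ?_)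
    simp only [Finset.sum_const, Finset.card_univ, nsmul_eq_mul, ← hn]
    push_cast
    ring
  | succ t ih =>
    -- concavity: the Frank–Wolfe gap dominates the suboptimality
    have hgap : ∑ i, Real.log (∑ h, p h * Q h i) - ∑ i, Real.log (q t i) ≤
        ∑ i, Q (s t) i / q t i - n := by
      have a1 : ∀ i, Real.log (∑ h, p h * Q h i) - Real.log (q t i) ≤
          (∑ h, p h * Q h i) / q t i - 1 := fun i => by
        rw [← Real.log_div (by linarith [hrc i]) (by linarith [(hq t i).1])]
        exact Real.log_le_sub_one_of_pos
          (div_pos (by linarith [hrc i]) (by linarith [(hq t i).1]))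
      have a2 : ∑ i, (∑ h, p h * Q h i) / q t i ≤ ∑ i, Q (s t) i / q t i := by
        simp only [Finset.sum_div]
        rw [Finset.sum_comm]
        calc ∑ h, ∑ i, p h * Q h i / q t i = ∑ h, p h * ∑ i, Q h i / q t i := by
              simp only [Finset.mul_sum, mul_div_assoc]
          _ ≤ ∑ h, p h * ∑ i, Q (s t) i / q t i :=
              Finset.sum_le_sum fun h _ => mul_le_mul_of_nonneg_left (hmax t h) (hp h)
          _ = _ := by rw [← Finset.sum_mul, hp1, one_mul]
      rw [← Finset.sum_sub_distrib]
      refine (Finset.sum_le_sum fun i _ => a1 i).trans ?_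
      rw [Finset.sum_sub_distrib]
      simp only [Finset.sum_const, Finset.card_univ, nsmul_eq_mul, ← hn, mul_one]
      linarith
    have ht : (0 : ℝ) ≤ t := Nat.cast_nonneg t
    have he1 : 2 / ((t : ℝ) + 3) ≤ 1 := by rw [div_le_one (by linarith)]; linarith
    have hs := sum_log_segment_lower hc (hq t) (hQ (s t)) (by positivity) he1
    simp only [← hstep, ← hn, ← hC] at hs
    have hm := mul_le_mul_of_nonneg_left hgap (show 0 ≤ 2 / ((t : ℝ) + 3) by positivity)
    have hi := mul_le_mul_of_nonneg_left ih (show 0 ≤ 1 - 2 / ((t : ℝ) + 3) by linarith)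
    have key : (1 - 2 / ((t : ℝ) + 3)) * (4 / (t + 2)) + (2 / ((t : ℝ) + 3)) ^ 2 ≤
        4 / (((t + 1 : ℕ) : ℝ) + 2) := by
      push_cast
      rw [← sub_nonneg]
      have : 4 / ((t : ℝ) + 1 + 2) -
          ((1 - 2 / ((t : ℝ) + 3)) * (4 / (t + 2)) + (2 / ((t : ℝ) + 3)) ^ 2) =
          4 / ((t + 3) ^ 2 * (t + 2)) := by
        field_simp
        ring
      rw [this]
      positivity
    have hk := mul_le_mul_of_nonneg_left key (show 0 ≤ n * C by positivity)
    nlinarith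

/-- After `T ≥ 16 / c ^ 4` steps the first-order optimality condition of the logarithmic barrier
holds up to a constant factor. -/
lemma sum_div_le_two_mul_card {c : ℝ} (hc : 0 < c) (hc1 : c ≤ 1) (Q : η → ι → ℝ)
    (hQ : ∀ h i, c ≤ Q h i ∧ Q h i ≤ 1) (p : ℕ → η → ℝ) (s : ℕ → η)
    (hp : ∀ t h, 0 ≤ p t h) (hp1 : ∀ t, ∑ h, p t h = 1)
    (hmax : ∀ t h, ∑ i, Q h i / (∑ g, p t g * Q g i) ≤ ∑ i, Q (s t) i / (∑ g, p t g * Q g i))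
    (hstep : ∀ t i, ∑ g, p (t + 1) g * Q g i =
      (1 - 2 / ((t : ℝ) + 3)) * (∑ g, p t g * Q g i) + 2 / ((t : ℝ) + 3) * Q (s t) i)
    (T : ℕ) (hT : 16 * (1 / c ^ 2) ^ 2 ≤ T) (h : η) :
    ∑ i, Q h i / (∑ g, p T g * Q g i) ≤ 2 * Fintype.card ι := by
  classical
  have hq : ∀ t i, c ≤ ∑ g, p t g * Q g i ∧ ∑ g, p t g * Q g i ≤ 1 := fun t i => by
    constructor
    · calc c = ∑ g, p t g * c := by rw [← Finset.sum_mul, hp1, one_mul]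
        _ ≤ _ := Finset.sum_le_sum fun g _ => mul_le_mul_of_nonneg_left (hQ g i).1 (hp t g)
    · calc _ ≤ ∑ g, p t g * 1 :=
            Finset.sum_le_sum fun g _ => mul_le_mul_of_nonneg_left (hQ g i).2 (hp t g)
        _ = 1 := by rw [← Finset.sum_mul, hp1, one_mul]
  set n : ℝ := ((Fintype.card ι : ℕ) : ℝ) with hn
  have hn0 : 0 ≤ n := by positivity
  set C : ℝ := 1 / c ^ 2 with hC
  have hC1 : 1 ≤ C := by
    rw [hC, le_div_iff₀ (by positivity)]; nlinarith
  -- the step size balancing the suboptimality against the curvature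
  set e : ℝ := 1 / (2 * C) with he
  have he0 : 0 < e := by positivity
  have he1 : e ≤ 1 := by rw [he, div_le_one (by positivity)]; linarith
  have hlow := sum_log_segment_lower hc (hq T) (hQ h) he0.le he1
  have hsub := sum_log_sub_le hc hc1 Q hQ (fun t i => ∑ g, p t g * Q g i) s hq hmax hstep
    (fun g => (1 - e) * p T g + e * (Pi.single h 1 : η → ℝ) g)
    (fun g => by
      have : 0 ≤ (Pi.single h 1 : η → ℝ) g := by
        by_cases hg : g = h
        · subst hg; simp
        · simp [hg]
      have := hp T g
      have : 0 ≤ 1 - e := by linarith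
      positivity)
    (by simp [Finset.sum_add_distrib, ← Finset.mul_sum, hp1]) T
  have hmix : ∀ i, ∑ g, ((1 - e) * p T g + e * (Pi.single h 1 : η → ℝ) g) * Q g i =
      (1 - e) * (∑ g, p T g * Q g i) + e * Q h i := fun i => by
    simp only [add_mul, Finset.sum_add_distrib, mul_assoc, ← Finset.mul_sum]
    congr 2
    rw [Finset.sum_eq_single h]
    · simp
    · intro g _ hg; simp [hg]
    · simp
  simp only [hmix, ← hn, ← hC] at hsub hlow
  have h1 : e * (∑ i, Q h i / (∑ g, p T g * Q g i) - n) ≤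
      n * (e ^ 2 * C) + n * C * (4 / ((T : ℝ) + 2)) := by linarith
  have h2 : n * (e ^ 2 * C) = e * (n / 2) := by rw [he]; field_simp
  have h3 : n * C * (4 / ((T : ℝ) + 2)) ≤ e * (n / 2) := by
    have : 4 / ((T : ℝ) + 2) ≤ 1 / (4 * C ^ 2) := by
      rw [div_le_div_iff₀ (by positivity) (by positivity)]
      nlinarith
    calc _ ≤ n * C * (1 / (4 * C ^ 2)) := by gcongr
      _ = _ := by rw [he]; field_simp; ring
  have h4 : e * (∑ i, Q h i / (∑ g, p T g * Q g i) - n) ≤ e * n := by linarith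
  have := le_of_mul_le_mul_left h4 he0
  linarith

end Abstract

/-! ### The output of the first phase -/

section Deterministic

variable {X : Type*} {K : ℕ} {H : Finset (X → Fin K)}

/-- The indicator `𝟙{h(x) = y}`. -/
noncomputable def hit (h : X → Fin K) (z : X × Fin K) : ℝ := if h z.1 = z.2 then 1 else 0

lemma hit_nonneg (h : X → Fin K) (z : X × Fin K) : 0 ≤ hit h z := by
  unfold hit; split_ifs <;> norm_num

lemma hit_le_one (h : X → Fin K) (z : X × Fin K) : hit h z ≤ 1 := by
  unfold hit; split_ifs <;> norm_num

lemma hit_mul_self (h : X → Fin K) (z : X × Fin K) : hit h z * hit h z = hit h z := by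
  unfold hit; split_ifs <;> norm_num

/-- The predicate that a vector indexed by `H` is a probability distribution. -/
def IsDistr (p : H → ℝ) : Prop := (∀ h, 0 ≤ p h) ∧ ∑ h, p h = 1

lemma mixProb_half (p : H → ℝ) (z : X × Fin K) :
    mixProb (1 / 2) p z.1 z.2 = 1 / 2 * ∑ h : H, p h * hit h.1 z + 1 / 2 / K := by
  unfold mixProb hit
  norm_num

lemma mixProb_eq_sum {p : H → ℝ} (hp : ∑ h, p h = 1) (z : X × Fin K) :
    mixProb (1 / 2) p z.1 z.2 = ∑ h : H, p h * (1 / 2 * hit h.1 z + 1 / 2 / K) := by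
  rw [mixProb_half]
  simp only [mul_add, Finset.sum_add_distrib, ← Finset.sum_mul, hp, one_mul, Finset.mul_sum]
  congr 1
  exact Finset.sum_congr rfl fun h _ => by ring

lemma mixProb_ge {p : H → ℝ} (hp : IsDistr p) (z : X × Fin K) :
    1 / 2 / (K : ℝ) ≤ mixProb (1 / 2) p z.1 z.2 := by
  rw [mixProb_half]
  have : 0 ≤ ∑ h : H, p h * hit h.1 z :=
    Finset.sum_nonneg fun h _ => mul_nonneg (hp.1 h) (hit_nonneg _ _)
  linarith

lemma mixProb_pos (hK : 0 < K) {p : H → ℝ} (hp : IsDistr p) (z : X × Fin K) :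
    0 < mixProb (1 / 2) p z.1 z.2 :=
  lt_of_lt_of_le (by positivity) (mixProb_ge hp z)

lemma inv_mixProb_le (hK : 0 < K) {p : H → ℝ} (hp : IsDistr p) (z : X × Fin K) :
    (mixProb (1 / 2) p z.1 z.2)⁻¹ ≤ 2 * K := by
  rw [inv_le_comm₀ (mixProb_pos hK hp z) (by positivity)]
  refine le_trans (le_of_eq ?_) (mixProb_ge hp z)
  field_simp

lemma isDistr_delta (h : H) : IsDistr (delta h) := by
  classical
  unfold delta
  refine ⟨fun g => ?_, ?_⟩
  · by_cases hg : g = h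
    · subst hg; simp
    · simp [hg]
  · simp

lemma IsDistr.segment {p q : H → ℝ} (hp : IsDistr p) (hq : IsDistr q) {e : ℝ} (he : 0 ≤ e)
    (he1 : e ≤ 1) : IsDistr ((1 - e) • p + e • q) := by
  refine ⟨fun h => ?_, ?_⟩
  · have h1 := hp.1 h
    have h2 := hq.1 h
    have h3 : 0 ≤ 1 - e := by linarith
    simp only [Pi.add_apply, Pi.smul_apply, smul_eq_mul]
    positivity
  · simp only [Pi.add_apply, Pi.smul_apply, smul_eq_mul, Finset.sum_add_distrib,
      ← Finset.mul_sum, hp.2, hq.2]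
    ring

variable [MeasurableSpace X]

lemma frankWolfe_succ_val (E : ERMOracle H) (γ : ℝ) (S : List (X × Fin K)) (h₀ : H) (t : ℕ) :
    (frankWolfe E γ S h₀ (t + 1)).val =
      (1 - 2 / (2 + ((t + 1 : ℕ) : ℝ))) • (frankWolfe E γ S h₀ t).val +
        (2 / (2 + ((t + 1 : ℕ) : ℝ))) •
          delta (E.run (phaseOneData γ (frankWolfe E γ S h₀ t).val S)) := rfl

lemma frankWolfe_calls (E : ERMOracle H) (γ : ℝ) (S : List (X × Fin K)) (h₀ : H) (t : ℕ) :
    (frankWolfe E γ S h₀ t).calls = t := by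
  induction t with
  | zero => rfl
  | succ t ih =>
    change (frankWolfe E γ S h₀ t).calls + (1 + 0) = t + 1
    rw [ih]

lemma runOn_calls (E : ERMOracle H) (γ : ℝ) (h₀ : H) (T : ℕ) {N₁ N₂ : ℕ}
    (w : (Fin N₁ → Round X K) × (Fin N₂ → Round X K)) :
    (runOn E γ h₀ T w).calls = T + 1 := by
  change (frankWolfe E γ _ h₀ T).calls + 1 = T + 1
  rw [frankWolfe_calls]

lemma isDistr_frankWolfe (E : ERMOracle H) (γ : ℝ) (S : List (X × Fin K)) (h₀ : H) (t : ℕ) :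
    IsDistr (frankWolfe E γ S h₀ t).val := by
  induction t with
  | zero => exact isDistr_delta h₀
  | succ t ih =>
    rw [frankWolfe_succ_val]
    refine ih.segment (isDistr_delta _) (by positivity) ?_
    rw [div_le_one (by positivity)]
    push_cast
    linarith [(Nat.cast_nonneg t : (0 : ℝ) ≤ t)]

/-- On the oracle inputs of the first phase the oracle maximizes the importance-weighted number
of correct labels. -/
lemma sum_hit_div_le_run (hK : 0 < K) (E : ERMOracle H) (S : List (X × Fin K)) {p : H → ℝ}
    (hp : IsDistr p) (h : H) :
    ∑ i : Fin S.length, hit h.1 S[i] / mixProb (1 / 2) p S[i].1 S[i].2 ≤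
      ∑ i : Fin S.length, hit (E.run (phaseOneData (1 / 2) p S)).1 S[i] /
        mixProb (1 / 2) p S[i].1 S[i].2 := by
  have hm := E.isMax (phaseOneData (1 / 2) p S) (by
    intro d hd y
    simp only [phaseOneData, List.mem_map] at hd
    obtain ⟨a, -, rfl⟩ := hd
    have := mixProb_pos hK hp (a.1, y)
    simp only at this ⊢
    have h1 : (0 : ℝ) ≤ if a.2 = y then 1 else 0 := by split_ifs <;> norm_num
    have h2 : (0 : ℝ) ≤ 1 - 1 / 2 := by norm_num
    positivity) h.1 h.2
  have key : ∀ g : H, ((phaseOneData (1 / 2) p S).map fun d => d.2 (g.1 d.1)).sum =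
      1 / (S.length : ℝ) * (1 - 1 / 2) *
        ∑ i : Fin S.length, hit g.1 S[i] / mixProb (1 / 2) p S[i].1 S[i].2 := by
    intro g
    have hfun : ((fun d : X × (Fin K → ℝ) => d.2 (g.1 d.1)) ∘ fun d : X × Fin K =>
        (d.1, fun y => 1 / (S.length : ℝ) * (1 - 1 / 2) *
          ((if d.2 = y then 1 else 0) / mixProb (1 / 2) p d.1 y))) =
        fun d => 1 / (S.length : ℝ) * (1 - 1 / 2) *
          (hit g.1 d / mixProb (1 / 2) p d.1 d.2) := by
      funext d
      simp only [Function.comp, hit]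
      by_cases hd : g.1 d.1 = d.2
      · simp [hd]
      · have : ¬ d.2 = g.1 d.1 := fun h => hd h.symm
        simp [hd, this]
    rw [phaseOneData, List.map_map, hfun, ← Fin.sum_univ_fun_getElem, Finset.mul_sum]
    rfl
  rw [key, key] at hm
  rcases Nat.eq_zero_or_pos S.length with h0 | h0
  · have : IsEmpty (Fin S.length) := by rw [h0]; infer_instance
    simp
  · exact le_of_mul_le_mul_left hm (by norm_num; exact h0)

/-- The distribution computed in the first phase has bounded empirical inverse probabilities along
every hypothesis. -/
lemma sum_hit_div_frankWolfe_le (hK : 0 < K) (E : ERMOracle H) (S : List (X × Fin K)) (h₀ : H)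
    {T : ℕ} (hT : 256 * (K : ℝ) ^ 4 ≤ T) (h : H) :
    (S.map fun d => hit h.1 d /
      mixProb (1 / 2) (frankWolfe E (1 / 2) S h₀ T).val d.1 d.2).sum ≤ 4 * S.length := by
  have hK1 : (1 : ℝ) ≤ K := by exact_mod_cast hK
  set c : ℝ := 1 / 2 / K with hc
  have hc0 : 0 < c := by positivity
  have hc1 : c ≤ 1 / 2 := by rw [hc, div_le_iff₀ (by positivity)]; linarith
  set P : ℕ → H → ℝ := fun t => (frankWolfe E (1 / 2) S h₀ t).val with hP
  have hPd : ∀ t, IsDistr (P t) := isDistr_frankWolfe E (1 / 2) S h₀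
  set Q : H → Fin S.length → ℝ := fun g i => 1 / 2 * hit g.1 S[i] + c with hQ
  have hmix : ∀ t (i : Fin S.length),
      mixProb (1 / 2) (P t) S[i].1 S[i].2 = ∑ g, P t g * Q g i :=
    fun t i => mixProb_eq_sum (hPd t).2 _
  have hsplit : ∀ t (g : H), ∑ i, Q g i / (∑ g, P t g * Q g i) =
      1 / 2 * ∑ i : Fin S.length, hit g.1 S[i] / mixProb (1 / 2) (P t) S[i].1 S[i].2 +
        ∑ i, c / (∑ g, P t g * Q g i) := by
    intro t g
    simp only [hmix, Finset.mul_sum, ← Finset.sum_add_distrib]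
    exact Finset.sum_congr rfl fun i _ => by simp only [hQ]; ring
  have main := sum_div_le_two_mul_card hc0 (by linarith) Q
    (fun g i => by
      have h0 := hit_nonneg g.1 S[i]
      have h1 := hit_le_one g.1 S[i]
      simp only [hQ]
      constructor <;> linarith)
    P (fun t => E.run (phaseOneData (1 / 2) (P t) S))
    (fun t => (hPd t).1) (fun t => (hPd t).2)
    (fun t g => by
      rw [hsplit, hsplit]
      linarith [sum_hit_div_le_run hK E S (hPd t) g])
    (fun t i => by
      classical
      have he : 2 / (2 + ((t + 1 : ℕ) : ℝ)) = 2 / ((t : ℝ) + 3) := by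
        congr 1; push_cast; ring
      have : P (t + 1) = _ := frankWolfe_succ_val E (1 / 2) S h₀ t
      rw [this, he]
      simp only [Pi.add_apply, Pi.smul_apply, smul_eq_mul, add_mul, Finset.sum_add_distrib,
        mul_assoc, ← Finset.mul_sum]
      congr 2
      rw [Finset.sum_eq_single (E.run (phaseOneData (1 / 2) (P t) S))]
      · simp [delta, hP]
      · intro g _ hg; simp [delta, hP] at hg ⊢; simp [hg]
      · simp)
    T (by
      refine le_trans (le_of_eq ?_) hT
      rw [hc]
      field_simp
      norm_num) h
  rw [hsplit, Fintype.card_fin] at main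
  have hpos : 0 ≤ ∑ i, c / (∑ g, P T g * Q g i) := Finset.sum_nonneg fun i _ => by
    rw [← hmix]
    exact (div_pos hc0 (mixProb_pos hK (hPd T) _)).le
  rw [← Fin.sum_univ_fun_getElem]
  have : ∀ i : Fin S.length, hit h.1 S[i.1] / mixProb (1 / 2) (P T) S[i.1].1 S[i.1].2 =
    hit h.1 S[i] / mixProb (1 / 2) (P T) S[i].1 S[i].2 := fun i => rfl
  rw [Finset.sum_congr rfl fun i _ => this i]
  linarith

end Deterministic

/-! ### Sparsification of distributions by sampling -/

section Sampling

variable {η : Type*} [Fintype η]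

/-- First and second moments of a sum of `m` independent centered samples from `p`. -/
lemma sum_prod_mul_sum_moments {p g : η → ℝ} (hp : ∑ h, p h = 1) (hg : ∑ h, p h * g h = 0)
    (m : ℕ) :
    ∑ ω : Fin m → η, (∏ i, p (ω i)) * ∑ i, g (ω i) = 0 ∧
    ∑ ω : Fin m → η, (∏ i, p (ω i)) * (∑ i, g (ω i)) ^ 2 = m * ∑ h, p h * g h ^ 2 := by
  induction m with
  | zero => simp
  | succ m ih =>
    have hW : ∑ ω : Fin m → η, ∏ i, p (ω i) = 1 := by
      rw [← Fintype.sum_pow, hp, one_pow]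
    have hcons : ∀ F : (Fin (m + 1) → η) → ℝ, ∑ ω, F ω =
        ∑ h, ∑ ω : Fin m → η, F (Fin.cons h ω) := by
      intro F
      rw [← Fintype.sum_prod_type']
      exact (Fintype.sum_equiv (Fin.consEquiv fun _ => η) _ _ fun x => rfl).symm
    rw [hcons, hcons]
    simp only [Fin.prod_univ_succ, Fin.sum_univ_succ, Fin.cons_zero, Fin.cons_succ]
    constructor
    · calc _ = ∑ h, (p h * g h * ∑ ω : Fin m → η, ∏ i, p (ω i) +
            p h * ∑ ω : Fin m → η, (∏ i, p (ω i)) * ∑ i, g (ω i)) := by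
            refine Finset.sum_congr rfl fun h _ => ?_
            rw [Finset.mul_sum, Finset.mul_sum, ← Finset.sum_add_distrib]
            exact Finset.sum_congr rfl fun ω _ => by ring
        _ = 0 := by simp [hW, ih.1, hg]
    · calc _ = ∑ h, (p h * g h ^ 2 * ∑ ω : Fin m → η, ∏ i, p (ω i) +
            2 * (p h * g h) * ∑ ω : Fin m → η, (∏ i, p (ω i)) * ∑ i, g (ω i) +
            p h * ∑ ω : Fin m → η, (∏ i, p (ω i)) * (∑ i, g (ω i)) ^ 2) := by
            refine Finset.sum_congr rfl fun h _ => ?_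
            rw [Finset.mul_sum, Finset.mul_sum, Finset.mul_sum, ← Finset.sum_add_distrib,
              ← Finset.sum_add_distrib]
            exact Finset.sum_congr rfl fun ω _ => by ring
        _ = _ := by
            simp only [hW, ih.1, ih.2, mul_one, mul_zero, add_zero, Finset.sum_add_distrib,
              ← Finset.sum_mul, hp]
            push_cast
            ring

end Sampling

section Empirical

variable {X : Type*} {K : ℕ} {H : Finset (X → Fin K)}

/-- The empirical distribution of a tuple of hypotheses (the zero vector for the empty tuple). -/
noncomputable def empDistr {m : ℕ} (ω : Fin m → H) : H → ℝ :=
  fun h => 1 / (m : ℝ) * ∑ i, delta (ω i) h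

lemma isDistr_empDistr {m : ℕ} (hm : 0 < m) (ω : Fin m → H) : IsDistr (empDistr ω) := by
  refine ⟨fun h => ?_, ?_⟩
  · have : 0 ≤ ∑ i, delta (ω i) h := Finset.sum_nonneg fun i _ => (isDistr_delta (ω i)).1 h
    unfold empDistr
    positivity
  · unfold empDistr
    rw [← Finset.mul_sum, Finset.sum_comm]
    simp only [(isDistr_delta _).2]
    simp [hm.ne']

lemma sum_delta_mul (h : H) (f : H → ℝ) : ∑ g, delta h g * f g = f h := by
  classical
  rw [Finset.sum_eq_single h]
  · simp [delta]
  · intro g _ hg; simp [delta, hg]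
  · simp

lemma mixProb_empDistr {m : ℕ} (ω : Fin m → H) (z : X × Fin K) :
    mixProb (1 / 2) (empDistr ω) z.1 z.2 =
      1 / 2 * (1 / (m : ℝ) * ∑ i, hit (ω i).1 z) + 1 / 2 / K := by
  rw [mixProb_half]
  congr 2
  simp only [empDistr, mul_assoc, ← Finset.mul_sum, Finset.sum_mul]
  rw [Finset.sum_comm]
  congr 1
  exact Finset.sum_congr rfl fun i _ => sum_delta_mul (ω i) fun g => hit g.1 z

/-- Sampling `m` hypotheses from `p` does not decrease the expected inverse probability (Jensen)
and increases it by at most `2 K³ / m`. -/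
lemma sum_prod_mul_inv_mixProb {m : ℕ} (hK : 0 < K) (hm : 0 < m) {p : H → ℝ} (hp : IsDistr p)
    (z : X × Fin K) :
    (mixProb (1 / 2) p z.1 z.2)⁻¹ ≤
      ∑ ω : Fin m → H, (∏ i, p (ω i)) * (mixProb (1 / 2) (empDistr ω) z.1 z.2)⁻¹ ∧
    ∑ ω : Fin m → H, (∏ i, p (ω i)) * (mixProb (1 / 2) (empDistr ω) z.1 z.2)⁻¹ ≤
      (mixProb (1 / 2) p z.1 z.2)⁻¹ + 2 * (K : ℝ) ^ 3 / m := by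
  set μ : ℝ := ∑ h : H, p h * hit h.1 z with hμ
  set g : H → ℝ := fun h => hit h.1 z - μ with hg
  set q : ℝ := mixProb (1 / 2) p z.1 z.2 with hq
  set r : (Fin m → H) → ℝ := fun ω => mixProb (1 / 2) (empDistr ω) z.1 z.2 with hr
  set W : (Fin m → H) → ℝ := fun ω => ∏ i, p (ω i) with hW
  have hm' : (0 : ℝ) < m := by exact_mod_cast hm
  have hq0 : 0 < q := mixProb_pos hK hp z
  have hr0 : ∀ ω, 0 < r ω := fun ω => mixProb_pos hK (isDistr_empDistr hm ω) z
  have hW0 : ∀ ω, 0 ≤ W ω := fun ω => Finset.prod_nonneg fun i _ => hp.1 _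
  have hW1 : ∑ ω, W ω = 1 := by
    simp only [hW]; rw [← Fintype.sum_pow, hp.2, one_pow]
  have hcent : ∑ h, p h * g h = 0 := by
    simp only [hg, mul_sub, Finset.sum_sub_distrib, ← Finset.sum_mul, hp.2]
    rw [hμ]; ring
  obtain ⟨h1, h2⟩ := sum_prod_mul_sum_moments hp.2 hcent m
  have hμ0 : 0 ≤ μ := Finset.sum_nonneg fun h _ => mul_nonneg (hp.1 h) (hit_nonneg _ _)
  have hμ1 : μ ≤ 1 := by
    calc μ ≤ ∑ h : H, p h * 1 :=
          Finset.sum_le_sum fun h _ => mul_le_mul_of_nonneg_left (hit_le_one _ _) (hp.1 h)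
      _ = 1 := by simp only [mul_one, hp.2]
  have hvar : ∑ h, p h * g h ^ 2 ≤ 1 := by
    calc _ ≤ ∑ h : H, p h * 1 := by
          refine Finset.sum_le_sum fun h _ => mul_le_mul_of_nonneg_left ?_ (hp.1 h)
          have a0 := hit_nonneg h.1 z
          have a1 := hit_le_one h.1 z
          simp only [hg]
          nlinarith
      _ = 1 := by simp only [mul_one, hp.2]
  have hdiff : ∀ ω, r ω - q = 1 / (2 * m) * ∑ i, g (ω i) := fun ω => by
    simp only [hr, hq]
    rw [mixProb_empDistr, mixProb_half, ← hμ]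
    simp only [hg, Finset.sum_sub_distrib, Finset.sum_const, Finset.card_univ, Fintype.card_fin,
      nsmul_eq_mul]
    field_simp
    ring
  -- exact second-order expansion of the inverse around `q`
  have hexp : ∀ ω, (r ω)⁻¹ = q⁻¹ - (r ω - q) * (q⁻¹) ^ 2 +
      (r ω - q) ^ 2 * ((q⁻¹) ^ 2 * (r ω)⁻¹) := fun ω => by
    have := (hr0 ω).ne'
    field_simp
    ring
  have hsum : ∑ ω, W ω * (r ω)⁻¹ =
      q⁻¹ + ∑ ω, W ω * ((r ω - q) ^ 2 * ((q⁻¹) ^ 2 * (r ω)⁻¹)) := by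
    have hlin : ∑ ω, W ω * ((r ω - q) * (q⁻¹) ^ 2) = 0 := by
      calc _ = (q⁻¹) ^ 2 * (1 / (2 * m)) * ∑ ω, W ω * ∑ i, g (ω i) := by
            rw [Finset.mul_sum]
            exact Finset.sum_congr rfl fun ω _ => by rw [hdiff]; ring
        _ = 0 := by rw [h1, mul_zero]
    calc _ = ∑ ω, (W ω * q⁻¹ - W ω * ((r ω - q) * (q⁻¹) ^ 2) +
          W ω * ((r ω - q) ^ 2 * ((q⁻¹) ^ 2 * (r ω)⁻¹))) := by
          refine Finset.sum_congr rfl fun ω _ => ?_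
          rw [← mul_sub, ← mul_add, ← hexp]
      _ = _ := by
          rw [Finset.sum_add_distrib, Finset.sum_sub_distrib, hlin, ← Finset.sum_mul, hW1]
          ring
  rw [hsum]
  constructor
  · have : 0 ≤ ∑ ω, W ω * ((r ω - q) ^ 2 * ((q⁻¹) ^ 2 * (r ω)⁻¹)) :=
      Finset.sum_nonneg fun ω _ => by
        have := hr0 ω
        have := hW0 ω
        positivity
    linarith
  · have hb : ∀ ω, (q⁻¹) ^ 2 * (r ω)⁻¹ ≤ (2 * K) ^ 2 * (2 * K) := fun ω => by
      have a1 : q⁻¹ ≤ 2 * K := inv_mixProb_le hK hp z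
      have a2 : (r ω)⁻¹ ≤ 2 * K := inv_mixProb_le hK (isDistr_empDistr hm ω) z
      have a3 := hr0 ω
      gcongr
    have : ∑ ω, W ω * ((r ω - q) ^ 2 * ((q⁻¹) ^ 2 * (r ω)⁻¹)) ≤
        (2 * K) ^ 2 * (2 * K) * (1 / (2 * m)) ^ 2 * ∑ ω, W ω * (∑ i, g (ω i)) ^ 2 := by
      rw [Finset.mul_sum]
      refine Finset.sum_le_sum fun ω _ => ?_
      calc W ω * ((r ω - q) ^ 2 * ((q⁻¹) ^ 2 * (r ω)⁻¹)) ≤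
            W ω * ((r ω - q) ^ 2 * ((2 * K) ^ 2 * (2 * K))) := by
            have := hb ω
            have := hW0 ω
            gcongr
        _ = _ := by rw [hdiff]; ring
    rw [h2] at this
    have h3 : (2 * (K : ℝ)) ^ 2 * (2 * K) * (1 / (2 * m)) ^ 2 * (m * ∑ h, p h * g h ^ 2) ≤
        (2 * (K : ℝ)) ^ 2 * (2 * K) * (1 / (2 * m)) ^ 2 * (m * 1) := by
      gcongr
    have h4 : (2 * (K : ℝ)) ^ 2 * (2 * K) * (1 / (2 * m)) ^ 2 * (m * 1) =
        2 * (K : ℝ) ^ 3 / m := by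
      field_simp
    linarith

end Empirical

/-! ### A Bernstein inequality for independent rounds -/

lemma exp_le_one_add_add_sq {x : ℝ} (hx : x ≤ 1) : Real.exp x ≤ 1 + x + x ^ 2 := by
  rcases le_or_gt (-1) x with h | h
  · have := Real.abs_exp_sub_one_sub_id_le (abs_le.mpr ⟨h, hx⟩)
    linarith [(abs_le.mp this).2]
  · have : Real.exp x ≤ 1 := Real.exp_le_one_iff.mpr (by linarith)
    nlinarith

/-- Bernstein-type tail bound for a sum of i.i.d. bounded variables with second moment at
most `v`, in the form before the choice of the exponential parameter `s`. -/
lemma pi_real_sum_ge_le {Ω : Type*} [MeasurableSpace Ω] (μ : Measure Ω) [IsProbabilityMeasure μ]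
    {f : Ω → ℝ} (hf : Measurable f) {B : ℝ} (hB : ∀ x, |f x| ≤ B) {s v a : ℝ} (hs : 0 ≤ s)
    (hb : ∀ x, s * f x ≤ 1) (hv : ∫ x, f x ^ 2 ∂μ ≤ v) (N : ℕ) :
    (Measure.pi fun _ : Fin N => μ).real {w | N * (∫ x, f x ∂μ + a) ≤ ∑ i, f (w i)} ≤
      Real.exp (-(N * (s * a - s ^ 2 * v))) := by
  have hfi : Integrable f μ := .of_bound hf.aestronglyMeasurable B (.of_forall hB)
  have hf2 : Integrable (fun x => f x ^ 2) μ := by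
    refine .of_bound (hf.pow_const 2).aestronglyMeasurable (B ^ 2) (.of_forall fun x => ?_)
    rw [Real.norm_eq_abs, abs_pow]
    exact pow_le_pow_left₀ (abs_nonneg _) (hB x) 2
  have hei : Integrable (fun x => Real.exp (s * f x)) μ := by
    refine .of_bound (by fun_prop) (Real.exp 1) (.of_forall fun x => ?_)
    rw [Real.norm_eq_abs, abs_of_pos (Real.exp_pos _)]
    exact Real.exp_le_exp.mpr (hb x)
  have hmgf : ∫ x, Real.exp (s * f x) ∂μ ≤ Real.exp (s * ∫ x, f x ∂μ + s ^ 2 * v) := by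
    calc _ ≤ ∫ x, (1 + s * f x + s ^ 2 * f x ^ 2) ∂μ := by
          refine integral_mono hei (((integrable_const 1).add (hfi.const_mul s)).add
            (hf2.const_mul _)) fun x => ?_
          have := exp_le_one_add_add_sq (hb x)
          rwa [mul_pow] at this
      _ = 1 + s * ∫ x, f x ∂μ + s ^ 2 * ∫ x, f x ^ 2 ∂μ := by
          have hi : Integrable (fun x => 1 + s * f x) μ :=
            (integrable_const 1).add (hfi.const_mul s)
          rw [integral_add hi (hf2.const_mul _), integral_add (integrable_const 1)
            (hfi.const_mul s), integral_const_mul, integral_const_mul]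
          simp
      _ ≤ (s * ∫ x, f x ∂μ + s ^ 2 * v) + 1 := by
          have := mul_le_mul_of_nonneg_left hv (sq_nonneg s)
          linarith
      _ ≤ _ := Real.add_one_le_exp _
  have hprod : ∀ w : Fin N → Ω, Real.exp (s * ∑ i, f (w i)) = ∏ i, Real.exp (s * f (w i)) :=
    fun w => by rw [Finset.mul_sum, Real.exp_sum]
  have hcher := measure_ge_le_exp_mul_mgf (μ := Measure.pi fun _ : Fin N => μ)
    (X := fun w => ∑ i, f (w i)) (t := s) (N * (∫ x, f x ∂μ + a)) hs (by
      simp only [hprod]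
      exact Integrable.fintype_prod fun i => hei)
  refine hcher.trans ?_
  have : mgf (fun w : Fin N → Ω => ∑ i, f (w i)) (Measure.pi fun _ : Fin N => μ) s =
      (∫ x, Real.exp (s * f x) ∂μ) ^ N := by
    unfold mgf
    simp only [hprod]
    rw [integral_fintype_prod_eq_pow (fun x => Real.exp (s * f x)), Fintype.card_fin]
  rw [this]
  calc _ ≤ Real.exp (-s * (N * (∫ x, f x ∂μ + a))) *
        Real.exp (s * ∫ x, f x ∂μ + s ^ 2 * v) ^ N := by
        gcongr
    _ = _ := by
        rw [← Real.exp_nat_mul, ← Real.exp_add]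
        congr 1
        ring

/-! ### Inverse probability rewards -/

section InvHit

variable {X : Type*} {K : ℕ} {H : Finset (X → Fin K)}

/-- The inverse probability reward `𝟙{h(x) = y} / p_γ(x, y)` at `γ = 1 / 2`. -/
noncomputable def invHit (p : H → ℝ) (h : X → Fin K) (z : X × Fin K) : ℝ :=
  hit h z / mixProb (1 / 2) p z.1 z.2

lemma invHit_nonneg (hK : 0 < K) {p : H → ℝ} (hp : IsDistr p) (h : X → Fin K)
    (z : X × Fin K) : 0 ≤ invHit p h z :=
  div_nonneg (hit_nonneg _ _) (mixProb_pos hK hp z).le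

lemma invHit_le (hK : 0 < K) {p : H → ℝ} (hp : IsDistr p) (h : X → Fin K)
    (z : X × Fin K) : invHit p h z ≤ 2 * K := by
  have h1 := inv_mixProb_le hK hp z
  have h2 := hit_le_one h z
  have h3 := hit_nonneg h z
  have h4 := mixProb_pos hK hp z
  unfold invHit
  rw [div_eq_mul_inv]
  calc _ ≤ 1 * (2 * (K : ℝ)) := by gcongr
    _ = _ := one_mul _

lemma mixProb_mul_invHit (hK : 0 < K) {p : H → ℝ} (hp : IsDistr p) (h : X → Fin K)
    (z : X × Fin K) : mixProb (1 / 2) p z.1 z.2 * invHit p h z = hit h z := by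
  have := (mixProb_pos hK hp z).ne'
  unfold invHit
  field_simp

lemma mixProb_mul_invHit_sq (hK : 0 < K) {p : H → ℝ} (hp : IsDistr p) (h : X → Fin K)
    (z : X × Fin K) : mixProb (1 / 2) p z.1 z.2 * invHit p h z ^ 2 = invHit p h z := by
  rw [sq, ← mul_assoc, mixProb_mul_invHit hK hp, invHit, ← mul_div_assoc, hit_mul_self]

lemma abs_invHit_le (hK : 0 < K) {p : H → ℝ} (hp : IsDistr p) (h : X → Fin K)
    (z : X × Fin K) : |invHit p h z| ≤ 2 * K := by
  rw [abs_of_nonneg (invHit_nonneg hK hp h z)]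
  exact invHit_le hK hp h z

/-- A function of the labeled pair, kept on the rounds with positive feedback and `0` on the
other rounds. -/
noncomputable def onCorrect (g : X × Fin K → ℝ) (w : Round X K) : ℝ :=
  if w.2 = w.1.2 then g w.1 else 0

lemma abs_onCorrect_le {g : X × Fin K → ℝ} {B : ℝ} (hB : ∀ z, |g z| ≤ B) (w : Round X K) :
    |onCorrect g w| ≤ B := by
  unfold onCorrect
  split_ifs
  · exact hB _
  · rw [abs_zero]; exact (abs_nonneg _).trans (hB w.1)

lemma onCorrect_sq (g : X × Fin K → ℝ) (w : Round X K) :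
    onCorrect g w ^ 2 = onCorrect (fun z => g z ^ 2) w := by
  unfold onCorrect
  split_ifs <;> simp

end InvHit

/-! ### Integrals over a round -/

section Integrals

variable {X : Type*} [MeasurableSpace X] {K : ℕ} {H : Finset (X → Fin K)}

lemma measurable_hit {h : X → Fin K} (hh : Measurable h) : Measurable (hit h) :=
  Measurable.ite (measurableSet_eq_fun (hh.comp measurable_fst) measurable_snd)
    measurable_const measurable_const

lemma measurable_mixProb (hH : ∀ h ∈ H, Measurable h) (γ : ℝ) (p : H → ℝ) :
    Measurable fun z : X × Fin K => mixProb γ p z.1 z.2 := by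
  have : (fun z : X × Fin K => mixProb γ p z.1 z.2) =
      fun z => (1 - γ) * (∑ h : H, p h * hit h.1 z) + γ / K := rfl
  rw [this]
  have := fun h : H => measurable_hit (hH h.1 h.2)
  fun_prop

lemma measurable_invHit (hH : ∀ h ∈ H, Measurable h) (p : H → ℝ) {h : X → Fin K}
    (hh : Measurable h) : Measurable (invHit p h) :=
  (measurable_hit hh).div (measurable_mixProb hH _ p)

/-- The expectation of `𝟙{h(x) = y} / p_γ(x, y)` under the data distribution, which is the second
moment of the second-phase reward estimator of `h`. -/
noncomputable def invReward (D : Measure (X × Fin K)) (p : H → ℝ) (h : X → Fin K) : ℝ :=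
  ∫ z, invHit p h z ∂D

lemma measurable_onCorrect {g : X × Fin K → ℝ} (hg : Measurable g) : Measurable (onCorrect g) :=
  Measurable.ite (measurableSet_eq_fun measurable_snd (measurable_snd.comp measurable_fst))
    (hg.comp measurable_fst) measurable_const

lemma isProbabilityMeasure_uniformOn_fin (hK : 0 < K) :
    IsProbabilityMeasure (uniformOn (Set.univ : Set (Fin K))) :=
  have : Nonempty (Fin K) := ⟨⟨0, hK⟩⟩
  isProbabilityMeasure_uniformOn Set.finite_univ Set.univ_nonempty

lemma isProbabilityMeasure_uniformRoundLaw (hK : 0 < K) (D : Measure (X × Fin K))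
    [IsProbabilityMeasure D] : IsProbabilityMeasure (uniformRoundLaw D) := by
  have := isProbabilityMeasure_uniformOn_fin hK
  unfold uniformRoundLaw
  infer_instance

lemma isProbabilityMeasure_mixRoundLaw (hK : 0 < K) (hH : ∀ h ∈ H, Measurable h)
    (D : Measure (X × Fin K)) [IsProbabilityMeasure D] {p : H → ℝ} (hp : IsDistr p) :
    IsProbabilityMeasure (mixRoundLaw D (1 / 2) p) := by
  have := isProbabilityMeasure_uniformRoundLaw hK D
  refine ⟨?_⟩
  have h1 : ∀ h : H, (D.map fun z : X × Fin K => (z, h.1 z.1)) Set.univ = 1 := fun h => by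
    have := hH h.1 h.2
    rw [Measure.map_apply (by fun_prop) MeasurableSet.univ]
    simp
  simp only [mixRoundLaw, Measure.add_apply, Measure.smul_apply, Measure.finsetSum_apply, h1,
    measure_univ, smul_eq_mul, mul_one]
  rw [← ENNReal.ofReal_sum_of_nonneg fun h _ => hp.1 h, hp.2,
    ← ENNReal.ofReal_mul (by norm_num), ← ENNReal.ofReal_add (by norm_num) (by norm_num)]
  norm_num

lemma integral_uniformOn_fin (hK : 0 < K) (f : Fin K → ℝ) :
    ∫ y, f y ∂(uniformOn (Set.univ : Set (Fin K))) = 1 / (K : ℝ) * ∑ y, f y := by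
  have := isProbabilityMeasure_uniformOn_fin hK
  rw [integral_fintype Integrable.of_finite, Finset.mul_sum]
  refine Finset.sum_congr rfl fun y _ => ?_
  rw [Measure.real, uniformOn_univ, Measure.count_singleton]
  simp

lemma integral_uniformRoundLaw_onCorrect (hK : 0 < K) (D : Measure (X × Fin K))
    [IsProbabilityMeasure D] {g : X × Fin K → ℝ} (hg : Measurable g) {B : ℝ}
    (hB : ∀ z, |g z| ≤ B) :
    ∫ w, onCorrect g w ∂(uniformRoundLaw D) = 1 / (K : ℝ) * ∫ z, g z ∂D := by
  have := isProbabilityMeasure_uniformOn_fin hK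
  have hint : Integrable (onCorrect g) (D.prod (uniformOn (Set.univ : Set (Fin K)))) :=
    .of_bound (measurable_onCorrect hg).aestronglyMeasurable B
      (.of_forall (abs_onCorrect_le hB))
  rw [uniformRoundLaw, integral_prod _ hint, ← integral_const_mul]
  refine integral_congr_ae (.of_forall fun z => ?_)
  simp only [integral_uniformOn_fin hK, onCorrect]
  simp

/-- In the second phase a labeled pair is observed with probability `p_γ(x, y)`, so dividing by it
gives unbiased estimates. -/
lemma integral_mixRoundLaw_onCorrect (hK : 0 < K) (hH : ∀ h ∈ H, Measurable h)
    (D : Measure (X × Fin K)) [IsProbabilityMeasure D] {p : H → ℝ} (hp : IsDistr p)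
    {g : X × Fin K → ℝ} (hg : Measurable g) {B : ℝ} (hB : ∀ z, |g z| ≤ B) :
    ∫ w, onCorrect g w ∂(mixRoundLaw D (1 / 2) p) =
      ∫ z, mixProb (1 / 2) p z.1 z.2 * g z ∂D := by
  have := isProbabilityMeasure_uniformRoundLaw hK D
  have hmap : ∀ h : H, Measurable fun z : X × Fin K => (z, h.1 z.1) := fun h => by
    have := hH h.1 h.2
    fun_prop
  have hpm : ∀ h : H, IsProbabilityMeasure (D.map fun z : X × Fin K => (z, h.1 z.1)) :=
    fun h => Measure.isProbabilityMeasure_map (hmap h).aemeasurable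
  have hgi : Integrable g D := .of_bound hg.aestronglyMeasurable B (.of_forall hB)
  have hint : ∀ (μ : Measure (Round X K)) [IsProbabilityMeasure μ], Integrable (onCorrect g) μ :=
    fun μ _ => .of_bound (measurable_onCorrect hg).aestronglyMeasurable B
      (.of_forall (abs_onCorrect_le hB))
  have hone : ∀ h : H, ∫ w, onCorrect g w ∂(D.map fun z : X × Fin K => (z, h.1 z.1)) =
      ∫ z, hit h.1 z * g z ∂D := fun h => by
    rw [integral_map (hmap h).aemeasurable (measurable_onCorrect hg).aestronglyMeasurable]
    refine integral_congr_ae (.of_forall fun z => ?_)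
    simp only [onCorrect, hit]
    split_ifs <;> simp
  have hhg : ∀ h : H, Integrable (fun z => hit h.1 z * g z) D := fun h =>
    .of_bound ((measurable_hit (hH h.1 h.2)).mul hg).aestronglyMeasurable B
      (.of_forall fun z => by
        rw [Real.norm_eq_abs, abs_mul, abs_of_nonneg (hit_nonneg _ _)]
        calc _ ≤ 1 * |g z| := mul_le_mul_of_nonneg_right (hit_le_one _ _) (abs_nonneg _)
          _ ≤ B := by rw [one_mul]; exact hB z)
  have hsm : ∀ h ∈ (Finset.univ : Finset H), Integrable (onCorrect g)
      (ENNReal.ofReal (p h) • D.map fun z : X × Fin K => (z, h.1 z.1)) := fun h _ =>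
    (hint _).smul_measure ENNReal.ofReal_ne_top
  rw [mixRoundLaw, integral_add_measure ((hint _).smul_measure ENNReal.ofReal_ne_top)
      ((integrable_finsetSum_measure.mpr hsm).smul_measure ENNReal.ofReal_ne_top),
    integral_smul_measure, integral_smul_measure, integral_finsetSum_measure hsm,
    integral_uniformRoundLaw_onCorrect hK D hg hB]
  simp only [integral_smul_measure, hone, smul_eq_mul]
  rw [ENNReal.toReal_ofReal (by norm_num), ENNReal.toReal_ofReal (by norm_num)]
  have : ∀ z : X × Fin K, mixProb (1 / 2) p z.1 z.2 * g z =
      1 / 2 / K * g z + ∑ h : H, 1 / 2 * p h * (hit h.1 z * g z) := fun z => by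
    rw [mixProb_half, add_mul, mul_assoc, Finset.sum_mul, Finset.mul_sum, add_comm]
    congr 1
    exact Finset.sum_congr rfl fun h _ => by ring
  simp only [this]
  rw [integral_add (hgi.const_mul _) (integrable_finsetSum _ fun h _ => (hhg h).const_mul _),
    integral_const_mul, integral_finsetSum _ fun h _ => (hhg h).const_mul _]
  simp only [integral_const_mul, Finset.mul_sum]
  congr 1
  · ring
  · refine Finset.sum_congr rfl fun h _ => ?_
    rw [ENNReal.toReal_ofReal (hp.1 h)]
    ring

end Integrals

/-! ### Tail bounds for the two phases -/

section Tails

variable {X : Type*} [MeasurableSpace X] {K : ℕ} {H : Finset (X → Fin K)}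

/-- The number of rounds with positive feedback is at most twice its expectation. -/
lemma pi_real_two_mul_le_sum_onCorrect_one (hK : 0 < K) (D : Measure (X × Fin K))
    [IsProbabilityMeasure D] (N : ℕ) :
    (Measure.pi fun _ : Fin N => uniformRoundLaw D).real
      {w | N * (2 / (K : ℝ)) ≤ ∑ i, onCorrect (fun _ => 1) (w i)} ≤
      Real.exp (-(N * (1 / (4 * (K : ℝ))))) := by
  have := isProbabilityMeasure_uniformRoundLaw hK D
  have hone : ∫ w, onCorrect (fun _ => (1 : ℝ)) w ∂(uniformRoundLaw D) = 1 / (K : ℝ) := by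
    rw [integral_uniformRoundLaw_onCorrect hK D measurable_const (B := 1) (by simp)]
    simp
  have h := pi_real_sum_ge_le (uniformRoundLaw D)
    (measurable_onCorrect (g := fun _ : X × Fin K => (1 : ℝ)) measurable_const)
    (B := 1) (abs_onCorrect_le (by simp)) (s := 1 / 2) (v := 1 / (K : ℝ)) (a := 1 / (K : ℝ))
    (by norm_num)
    (fun w => by
      have := (abs_le.mp (abs_onCorrect_le (g := fun _ => (1 : ℝ)) (B := 1) (by simp) w)).2
      linarith)
    (by simp only [onCorrect_sq, one_pow, hone]; exact le_rfl) N
  rw [hone] at h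
  convert h using 5
  · ring
  · field_simp; norm_num

/-- Lower tail for the importance-weighted number of correct labels in the first phase. The
summands are nonnegative and at most `2K`, so their second moment is at most `2K` times their mean,
and the failure probability of a deviation by half the mean depends on `F / K²` only. -/
lemma pi_real_sum_onCorrect_invHit_le (hK : 0 < K) (hH : ∀ h ∈ H, Measurable h)
    (D : Measure (X × Fin K)) [IsProbabilityMeasure D] {p : H → ℝ} (hp : IsDistr p)
    {h : X → Fin K} (hh : Measurable h) (hF : 32 ≤ invReward D p h) (N : ℕ) :
    (Measure.pi fun _ : Fin N => uniformRoundLaw D).real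
      {w | ∑ i, onCorrect (invHit p h) (w i) ≤ N * (invReward D p h / (2 * K))} ≤
      Real.exp (-(N * (1 / (K : ℝ) ^ 2))) := by
  have := isProbabilityMeasure_uniformRoundLaw hK D
  have hK' : (0 : ℝ) < K := by exact_mod_cast hK
  have hm := measurable_invHit hH p hh
  have hab := abs_invHit_le hK hp h
  set F := invReward D p h with hFdef
  have hmean : ∫ w, -onCorrect (invHit p h) w ∂(uniformRoundLaw D) = -(1 / (K : ℝ) * F) := by
    rw [integral_neg, integral_uniformRoundLaw_onCorrect hK D hm hab]
    rfl
  have hsq : ∫ w, (-onCorrect (invHit p h) w) ^ 2 ∂(uniformRoundLaw D) ≤ 2 * F := by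
    simp only [neg_sq, onCorrect_sq]
    rw [integral_uniformRoundLaw_onCorrect hK D (hm.pow_const 2) (B := (2 * K) ^ 2)
      (fun z => by rw [abs_pow]; exact pow_le_pow_left₀ (abs_nonneg _) (hab z) 2)]
    have hi : Integrable (invHit p h) D :=
      .of_bound hm.aestronglyMeasurable (2 * K) (.of_forall hab)
    -- self-bounding: the second moment is controlled by the mean
    have : ∫ z, invHit p h z ^ 2 ∂D ≤ ∫ z, 2 * K * invHit p h z ∂D := by
      refine integral_mono_of_nonneg (.of_forall fun z => sq_nonneg _) (hi.const_mul _)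
        (.of_forall fun z => ?_)
      simp only [sq]
      exact mul_le_mul_of_nonneg_right (invHit_le hK hp h z) (invHit_nonneg hK hp h z)
    rw [integral_const_mul] at this
    calc _ ≤ 1 / (K : ℝ) * (2 * K * F) := by gcongr; exact this
      _ = _ := by field_simp
  have hb := pi_real_sum_ge_le (uniformRoundLaw D) (f := fun w => -onCorrect (invHit p h) w)
    (measurable_onCorrect hm).neg (B := 2 * K)
    (fun w => by rw [abs_neg]; exact abs_onCorrect_le hab w)
    (s := 1 / (8 * K)) (v := 2 * F) (a := F / (2 * K)) (by positivity)
    (fun w => by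
      have h0 : 0 ≤ onCorrect (invHit p h) w := by
        unfold onCorrect
        split_ifs
        · exact invHit_nonneg hK hp h _
        · exact le_rfl
      have h1 : 0 ≤ 1 / (8 * (K : ℝ)) * onCorrect (invHit p h) w := by positivity
      linarith) hsq N
  rw [hmean] at hb
  refine le_trans (le_of_eq ?_) (hb.trans (Real.exp_le_exp.mpr ?_))
  · congr 1
    ext w
    simp only [Set.mem_ofPred_eq, Finset.sum_neg_distrib]
    have : (N : ℝ) * (-(1 / (K : ℝ) * F) + F / (2 * K)) = -(N * (F / (2 * K))) := by
      field_simp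
      ring
    rw [this, neg_le_neg_iff]
  · rw [neg_le_neg_iff]
    refine mul_le_mul_of_nonneg_left ?_ (Nat.cast_nonneg N)
    have : 1 / (8 * (K : ℝ)) * (F / (2 * K)) - (1 / (8 * K)) ^ 2 * (2 * F) =
        F / 32 * (1 / (K : ℝ) ^ 2) := by
      field_simp
      norm_num
    rw [this]
    have h1 : 1 ≤ F / 32 := by linarith
    have h2 : 0 ≤ 1 / (K : ℝ) ^ 2 := by positivity
    nlinarith

/-- In the second phase a hypothesis that is worse than `h'` by more than `ε` beats `h'` on the
estimated rewards with exponentially small probability. -/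
lemma pi_real_sum_le_sum_onCorrect (hK : 0 < K) (hH : ∀ h ∈ H, Measurable h)
    (D : Measure (X × Fin K)) [IsProbabilityMeasure D] {p : H → ℝ} (hp : IsDistr p)
    {h h' : X → Fin K} (hh : Measurable h) (hh' : Measurable h') {V ε : ℝ} (hV : 0 < V)
    (hF : invReward D p h ≤ V) (hF' : invReward D p h' ≤ V) (hε : 0 < ε)
    (hgap : ε < reward D h' - reward D h) (N : ℕ) :
    (Measure.pi fun _ : Fin N => mixRoundLaw D (1 / 2) p).real
      {w | ∑ i, onCorrect (invHit p h') (w i) ≤ ∑ i, onCorrect (invHit p h) (w i)} ≤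
      Real.exp (-(N * (ε ^ 2 / (4 * K * ε + 8 * V)))) := by
  have := isProbabilityMeasure_mixRoundLaw hK hH D hp
  have hK' : (0 : ℝ) < K := by exact_mod_cast hK
  have hint : ∀ g : X × Fin K → ℝ, Measurable g → ∀ B : ℝ, (∀ z, |g z| ≤ B) →
      Integrable (onCorrect g) (mixRoundLaw D (1 / 2) p) := fun g hg B hB =>
    .of_bound (measurable_onCorrect hg).aestronglyMeasurable B (.of_forall (abs_onCorrect_le hB))
  have hm := fun {g : X → Fin K} (hg : Measurable g) => measurable_invHit hH p hg
  have hab := fun g : X → Fin K => abs_invHit_le hK hp g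
  have hab2 : ∀ (g : X → Fin K) z, |invHit p g z ^ 2| ≤ (2 * K) ^ 2 := fun g z => by
    rw [abs_pow]; exact pow_le_pow_left₀ (abs_nonneg _) (hab g z) 2
  have hmean : ∀ {g : X → Fin K}, Measurable g →
      ∫ w, onCorrect (invHit p g) w ∂(mixRoundLaw D (1 / 2) p) = reward D g := fun {g} hg => by
    rw [integral_mixRoundLaw_onCorrect hK hH D hp (hm hg) (hab g)]
    simp only [mixProb_mul_invHit hK hp]
    rfl
  have hsec : ∀ {g : X → Fin K}, Measurable g →
      ∫ w, onCorrect (fun z => invHit p g z ^ 2) w ∂(mixRoundLaw D (1 / 2) p) =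
        invReward D p g := fun {g} hg => by
    rw [integral_mixRoundLaw_onCorrect hK hH D hp ((hm hg).pow_const 2) (hab2 g)]
    simp only [mixProb_mul_invHit_sq hK hp]
    rfl
  have hnn : ∀ (g : X → Fin K) w, 0 ≤ onCorrect (invHit p g) w := fun g w => by
    unfold onCorrect
    split_ifs
    · exact invHit_nonneg hK hp g _
    · exact le_rfl
  set f : Round X K → ℝ := fun w => onCorrect (invHit p h) w - onCorrect (invHit p h') w with hf
  have hfmean : ∫ w, f w ∂(mixRoundLaw D (1 / 2) p) = reward D h - reward D h' := by
    rw [integral_sub (hint _ (hm hh) _ (hab h)) (hint _ (hm hh') _ (hab h')), hmean hh, hmean hh']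
  have hfsq : ∫ w, f w ^ 2 ∂(mixRoundLaw D (1 / 2) p) ≤ 2 * V := by
    have hi := hint _ ((hm hh).pow_const 2) _ (hab2 h)
    have hi' := hint _ ((hm hh').pow_const 2) _ (hab2 h')
    calc _ ≤ ∫ w, (onCorrect (fun z => invHit p h z ^ 2) w +
          onCorrect (fun z => invHit p h' z ^ 2) w) ∂(mixRoundLaw D (1 / 2) p) := by
          refine integral_mono_of_nonneg (.of_forall fun w => sq_nonneg _) (hi.add hi')
            (.of_forall fun w => ?_)
          simp only [hf, ← onCorrect_sq]
          have := mul_nonneg (hnn h w) (hnn h' w)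
          nlinarith
      _ = invReward D p h + invReward D p h' := by
          rw [integral_add hi hi', hsec hh, hsec hh']
      _ ≤ _ := by linarith
  -- an exponential parameter of order `min (1 / K) (ε / V)`: `s * 2K ≤ 1` allows the exponential
  -- bound, and `s * 2V ≤ ε / 2` makes the quadratic term at most half of the linear one
  set s : ℝ := ε / (2 * K * ε + 4 * V) with hs
  have hden : 0 < 2 * K * ε + 4 * V := by positivity
  have hs0 : 0 ≤ s := by positivity
  have hb := pi_real_sum_ge_le (mixRoundLaw D (1 / 2) p) (f := f)
    ((measurable_onCorrect (hm hh)).sub (measurable_onCorrect (hm hh'))) (B := 2 * K + 2 * K)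
    (fun w => (abs_sub _ _).trans
      (add_le_add (abs_onCorrect_le (hab h) w) (abs_onCorrect_le (hab h') w)))
    (s := s) (v := 2 * V) (a := ε) hs0
    (fun w => by
      have h1 : f w ≤ 2 * K := by
        have h2 := (abs_le.mp (abs_onCorrect_le (hab h) w)).2
        have h3 := hnn h' w
        simp only [hf]
        linarith
      calc s * f w ≤ s * (2 * K) := mul_le_mul_of_nonneg_left h1 hs0
        _ ≤ 1 := by
          rw [hs, div_mul_eq_mul_div, div_le_one hden]
          nlinarith) hfsq N
  refine le_trans (measureReal_mono ?_) (hb.trans (Real.exp_le_exp.mpr ?_))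
  · intro w hw
    simp only [Set.mem_ofPred_eq] at hw ⊢
    rw [hfmean]
    simp only [hf, Finset.sum_sub_distrib]
    have : (N : ℝ) * (reward D h - reward D h' + ε) ≤ 0 :=
      mul_nonpos_of_nonneg_of_nonpos (Nat.cast_nonneg N) (by linarith)
    linarith
  · rw [neg_le_neg_iff]
    refine mul_le_mul_of_nonneg_left ?_ (Nat.cast_nonneg N)
    have h1 : ε ^ 2 / (4 * K * ε + 8 * V) = s * (ε / 2) := by
      rw [hs]
      field_simp
      ring
    have h2 : s * (2 * V) ≤ ε / 2 := by
      rw [hs, div_mul_eq_mul_div, div_le_iff₀ hden]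
      nlinarith [mul_pos hK' (mul_pos hε hε)]
    rw [h1]
    nlinarith

end Tails

/-! ### The rounds seen through the oracle -/

section Samples

variable {X : Type*} {K : ℕ} {H : Finset (X → Fin K)}

lemma sum_map_filter_eq {α : Type*} (l : List α) (P : α → Bool) (F : α → ℝ) :
    ((l.filter P).map F).sum = (l.map fun a => if P a then F a else 0).sum := by
  induction l with
  | nil => simp
  | cons a l ih =>
    by_cases h : P a = true
    · simp [h, ih]
    · simp [h, ih]

lemma sum_map_labeledSample {n : ℕ} (w : Fin n → Round X K) (F : X × Fin K → ℝ) :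
    ((labeledSample fun i => observe (w i)).map F).sum = ∑ i, onCorrect F (w i) := by
  rw [labeledSample, List.map_map, sum_map_filter_eq, List.map_ofFn, List.sum_ofFn]
  refine Finset.sum_congr rfl fun i _ => ?_
  simp only [Function.comp, observe, onCorrect, decide_eq_true_eq]
  by_cases h : (w i).2 = (w i).1.2
  · simp [h]
  · simp [h]

lemma length_labeledSample {n : ℕ} (w : Fin n → Round X K) :
    ((labeledSample fun i => observe (w i)).length : ℝ) =
      ∑ i, onCorrect (fun _ => 1) (w i) := by
  rw [← sum_map_labeledSample]
  simp

variable [MeasurableSpace X]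

/-- The hypothesis returned at the end maximizes the estimated rewards of the second phase. -/
lemma sum_onCorrect_le_run (hK : 0 < K) (E : ERMOracle H) {p : H → ℝ} (hp : IsDistr p) {n : ℕ}
    (w : Fin n → Round X K) (h : H) :
    ∑ i, onCorrect (invHit p h.1) (w i) ≤
      ∑ i, onCorrect (invHit p (E.run (phaseTwoData (1 / 2) p fun i => observe (w i))).1)
        (w i) := by
  have hm := E.isMax (phaseTwoData (1 / 2) p fun i => observe (w i)) (by
    intro d hd y
    simp only [phaseTwoData, List.mem_ofFn] at hd
    obtain ⟨i, rfl⟩ := hd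
    have := mixProb_pos hK hp ((observe (w i)).1, y)
    simp only at this ⊢
    refine div_nonneg ?_ this.le
    split_ifs <;> norm_num) h.1 h.2
  have key : ∀ g : X → Fin K, ((phaseTwoData (1 / 2) p fun i => observe (w i)).map
      fun d => d.2 (g d.1)).sum = ∑ i, onCorrect (invHit p g) (w i) := fun g => by
    rw [phaseTwoData, List.map_ofFn, List.sum_ofFn]
    refine Finset.sum_congr rfl fun i _ => ?_
    simp only [Function.comp, observe, onCorrect, invHit, hit, decide_eq_true_eq]
    by_cases h1 : (w i).2 = (w i).1.2
    · by_cases h2 : g (w i).1.1 = (w i).1.2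
      · simp [h1, h2]
      · have : ¬ (w i).1.2 = g (w i).1.1 := fun h => h2 h.symm
        simp [h1, h2, this]
    · simp [h1]
  rwa [key, key] at hm

end Samples

/-! ### Measurability of the computations -/

section Measurability

variable {X : Type*} [MeasurableSpace X] {K : ℕ} {H : Finset (X → Fin K)}

lemma measurable_comp_of_finite_range {Ω α β : Type*} [MeasurableSpace Ω] [MeasurableSpace β]
    {φ : Ω → α} (hfin : (Set.range φ).Finite) (hφ : ∀ a, MeasurableSet {ω | φ ω = a})
    (Ψ : α → β) : Measurable fun ω => Ψ (φ ω) := by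
  intro s _
  have : (fun ω => Ψ (φ ω)) ⁻¹' s = ⋃ a ∈ Set.range φ, ⋃ (_ : Ψ a ∈ s), {ω | φ ω = a} := by
    ext ω
    simp only [Set.mem_preimage, Set.mem_iUnion, Set.mem_ofPred_eq, exists_prop]
    exact ⟨fun h => ⟨_, ⟨ω, rfl⟩, h, rfl⟩, fun ⟨a, _, h, e⟩ => e ▸ h⟩
  rw [this]
  exact hfin.measurableSet_biUnion fun a _ => .iUnion fun _ => hφ a

lemma measurable_mixProb_left (hH : ∀ h ∈ H, Measurable h) (γ : ℝ) (p : H → ℝ) (y : Fin K) :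
    Measurable fun x : X => mixProb γ p x y :=
  Measurable.comp (g := fun z : X × Fin K => mixProb γ p z.1 z.2) (f := fun x => (x, y))
    (measurable_mixProb hH γ p) (by fun_prop)

/-- The oracle's answer on the data of the first phase is a measurable function of the rounds. The
length of the sample is random, but it is fixed once the pattern of positive feedback is. -/
lemma measurableSet_run_phaseOneData (hH : ∀ h ∈ H, Measurable h) (E : ERMOracle H) (γ : ℝ)
    (p : H → ℝ) {n : ℕ} (h : H) :
    MeasurableSet {w : Fin n → Round X K |
      E.run (phaseOneData γ p (labeledSample fun i => observe (w i))) = h} := by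
  set l : (Fin n → Bool) → List (Fin n) := fun b => (List.finRange n).filter b with hl
  set G : ℕ → Round X K → X × (Fin K → ℝ) := fun k w => (w.1.1, fun y =>
    1 / (k : ℝ) * (1 - γ) * ((if w.2 = y then 1 else 0) / mixProb γ p w.1.1 y)) with hG
  have hGm : ∀ k, Measurable (G k) := fun k => by
    refine (measurable_fst.comp measurable_fst).prodMk (measurable_pi_lambda _ fun y => ?_)
    refine Measurable.const_mul (Measurable.div ?_ ?_) _
    · exact Measurable.ite (measurableSet_eq_fun measurable_snd measurable_const)
        measurable_const measurable_const
    · exact (measurable_mixProb_left hH γ p y).comp (measurable_fst.comp measurable_fst)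
  have hdata : ∀ (b : Fin n → Bool) (w : Fin n → Round X K),
      (∀ i, decide ((w i).2 = (w i).1.2) = b i) →
      phaseOneData γ p (labeledSample fun i => observe (w i)) =
        List.ofFn fun j => G (l b).length (w ((l b).get j)) := by
    intro b w hb
    have hS : (labeledSample fun i => observe (w i)) =
        (l b).map fun i => ((w i).1.1, (w i).2) := by
      rw [labeledSample, List.ofFn_eq_map, List.filter_map, List.map_map, hl]
      have : ((fun v : Obs X K => v.2.2) ∘ fun i => observe (w i)) = b := by
        funext i
        exact hb i
      rw [this]
      rfl
    rw [hS, phaseOneData, List.map_map, List.length_map]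
    conv_lhs => rw [← List.ofFn_get (l b)]
    rw [List.map_ofFn]
    congr 1
    funext j
    simp [hG, Function.comp]
  have hset : {w : Fin n → Round X K |
      E.run (phaseOneData γ p (labeledSample fun i => observe (w i))) = h} =
      ⋃ b : Fin n → Bool, (⋂ i, {w | decide ((w i).2 = (w i).1.2) = b i}) ∩
        (fun w (j : Fin (l b).length) => G (l b).length (w ((l b).get j))) ⁻¹'
          {S | E.run (List.ofFn S) = h} := by
    ext w
    simp only [Set.mem_ofPred_eq, Set.mem_iUnion, Set.mem_inter_iff, Set.mem_iInter,
      Set.mem_preimage]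
    constructor
    · intro hw
      exact ⟨fun i => decide ((w i).2 = (w i).1.2), fun i => rfl,
        by rwa [← hdata _ w fun i => rfl]⟩
    · rintro ⟨b, hb, hw⟩
      rwa [hdata b w hb]
  rw [hset]
  refine .iUnion fun b => .inter (.iInter fun i => ?_) ?_
  · have hm : MeasurableSet {w : Fin n → Round X K | (w i).2 = (w i).1.2} :=
      measurableSet_eq_fun (by fun_prop) (by fun_prop)
    cases b i
    · have : {w : Fin n → Round X K | decide ((w i).2 = (w i).1.2) = false} =
          {w | (w i).2 = (w i).1.2}ᶜ := by
        ext w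
        simp
      rw [this]
      exact hm.compl
    · simpa using hm
  · refine measurable_pi_lambda _ (fun j => ?_) (E.measurable _ h)
    exact (hGm _).comp (measurable_pi_apply _)

/-- The distribution computed in the first phase takes finitely many values, each of them on a
measurable set of rounds. -/
lemma frankWolfe_finite_range (hH : ∀ h ∈ H, Measurable h) (E : ERMOracle H) (γ : ℝ) (h₀ : H)
    (n t : ℕ) :
    (Set.range fun w : Fin n → Round X K =>
      (frankWolfe E γ (labeledSample fun i => observe (w i)) h₀ t).val).Finite ∧
    ∀ p : H → ℝ, MeasurableSet {w : Fin n → Round X K |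
      (frankWolfe E γ (labeledSample fun i => observe (w i)) h₀ t).val = p} := by
  induction t with
  | zero =>
    refine ⟨(Set.finite_singleton (delta h₀)).subset ?_, fun p => ?_⟩
    · rintro _ ⟨w, rfl⟩
      rfl
    · exact MeasurableSet.const (delta h₀ = p)
  | succ t ih =>
    obtain ⟨hfin, hmeas⟩ := ih
    set φ : (Fin n → Round X K) → H → ℝ := fun w =>
      (frankWolfe E γ (labeledSample fun i => observe (w i)) h₀ t).val with hφ
    set U : (H → ℝ) × H → H → ℝ := fun x =>
      (1 - 2 / (2 + ((t + 1 : ℕ) : ℝ))) • x.1 + (2 / (2 + ((t + 1 : ℕ) : ℝ))) • delta x.2 with hU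
    have hstep : ∀ w : Fin n → Round X K,
        (frankWolfe E γ (labeledSample fun i => observe (w i)) h₀ (t + 1)).val =
          U (φ w, E.run (phaseOneData γ (φ w) (labeledSample fun i => observe (w i)))) :=
      fun w => frankWolfe_succ_val E γ _ h₀ t
    simp only [hstep]
    refine ⟨((hfin.prod (Set.finite_univ (α := H))).image U).subset ?_, fun p => ?_⟩
    · rintro _ ⟨w, rfl⟩
      exact ⟨_, ⟨⟨w, rfl⟩, Set.mem_univ _⟩, rfl⟩
    · have hset : {w : Fin n → Round X K |
          U (φ w, E.run (phaseOneData γ (φ w) (labeledSample fun i => observe (w i)))) = p} =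
          ⋃ q ∈ Set.range φ, ⋃ h : H, ⋃ (_ : U (q, h) = p), {w | φ w = q} ∩
            {w | E.run (phaseOneData γ q (labeledSample fun i => observe (w i))) = h} := by
        ext w
        simp only [Set.mem_ofPred_eq, Set.mem_iUnion, Set.mem_inter_iff, exists_prop]
        constructor
        · intro hw
          exact ⟨φ w, ⟨w, rfl⟩, _, hw, rfl, rfl⟩
        · rintro ⟨q, -, h, hq, rfl, rfl⟩
          exact hq
      rw [hset]
      exact hfin.measurableSet_biUnion fun q _ => .iUnion fun h => .iUnion fun _ =>
        (hmeas q).inter (measurableSet_run_phaseOneData hH E γ q h)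

lemma measurableSet_run_phaseTwoData (hH : ∀ h ∈ H, Measurable h) (E : ERMOracle H) (γ : ℝ)
    (p : H → ℝ) {n : ℕ} (h : H) :
    MeasurableSet {w : Fin n → Round X K |
      E.run (phaseTwoData γ p fun i => observe (w i)) = h} := by
  refine measurable_pi_lambda (f := fun (w : Fin n → Round X K) (i : Fin n) =>
    ((observe (w i)).1, fun y => (if (observe (w i)).2.2 = true ∧ (observe (w i)).2.1 = y
      then (1 : ℝ) else 0) / mixProb γ p (observe (w i)).1 y)) (fun i => ?_) (E.measurable n h)
  have hx : Measurable fun w : Fin n → Round X K => (observe (w i)).1 := by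
    unfold observe
    fun_prop
  refine hx.prodMk (measurable_pi_lambda _ fun y => Measurable.div ?_ ?_)
  · refine Measurable.ite ?_ measurable_const measurable_const
    simp only [observe, decide_eq_true_eq]
    exact (measurableSet_eq_fun (by fun_prop) (by fun_prop)).inter
      (measurableSet_eq_fun (by fun_prop) measurable_const)
  · exact (measurable_mixProb_left hH γ p y).comp hx

lemma measurableSet_runOn (hH : ∀ h ∈ H, Measurable h) (E : ERMOracle H) (γ : ℝ) (h₀ : H)
    (T N₁ N₂ : ℕ) (P : H → Prop) :
    MeasurableSet {w : (Fin N₁ → Round X K) × (Fin N₂ → Round X K) |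
      P (runOn E γ h₀ T w).val} := by
  obtain ⟨hfin, hmeas⟩ := frankWolfe_finite_range hH E γ h₀ N₁ T
  have hset : {w : (Fin N₁ → Round X K) × (Fin N₂ → Round X K) |
      P (runOn E γ h₀ T w).val} = ⋃ q ∈ Set.range fun w : Fin N₁ → Round X K =>
        (frankWolfe E γ (labeledSample fun i => observe (w i)) h₀ T).val,
      ⋃ h : H, ⋃ (_ : P h), {w : (Fin N₁ → Round X K) |
        (frankWolfe E γ (labeledSample fun i => observe (w i)) h₀ T).val = q} ×ˢ
        {w : (Fin N₂ → Round X K) | E.run (phaseTwoData γ q fun i => observe (w i)) = h} := by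
    ext w
    simp only [Set.mem_ofPred_eq, Set.mem_iUnion, Set.mem_prod, exists_prop]
    constructor
    · intro hw
      exact ⟨_, ⟨w.1, rfl⟩, _, hw, rfl, rfl⟩
    · rintro ⟨q, -, h, hq, rfl, rfl⟩
      exact hq
  rw [hset]
  exact hfin.measurableSet_biUnion fun q _ => .iUnion fun h => .iUnion fun _ =>
    (hmeas q).prod (measurableSet_run_phaseTwoData hH E γ q h)

/-- The conditional law of the rounds of the second phase given those of the first. -/
noncomputable def secondPhaseKernel (hH : ∀ h ∈ H, Measurable h) (D : Measure (X × Fin K))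
    (E : ERMOracle H) (γ : ℝ) (h₀ : H) (N₁ N₂ T : ℕ) :
    Kernel (Fin N₁ → Round X K) (Fin N₂ → Round X K) where
  toFun w := Measure.pi fun _ => mixRoundLaw D γ (phaseOne E γ h₀ T fun i => observe (w i)).val
  measurable' :=
    measurable_comp_of_finite_range (frankWolfe_finite_range hH E γ h₀ N₁ T).1
      (frankWolfe_finite_range hH E γ h₀ N₁ T).2
      fun p => Measure.pi fun _ : Fin N₂ => mixRoundLaw D γ p

lemma isMarkovKernel_secondPhaseKernel (hK : 0 < K) (hH : ∀ h ∈ H, Measurable h)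
    (D : Measure (X × Fin K)) [IsProbabilityMeasure D] (E : ERMOracle H) (h₀ : H)
    (N₁ N₂ T : ℕ) : IsMarkovKernel (secondPhaseKernel hH D E (1 / 2) h₀ N₁ N₂ T) := by
  refine ⟨fun w => ?_⟩
  have : IsProbabilityMeasure (mixRoundLaw D (1 / 2)
      (phaseOne E (1 / 2) h₀ T fun i => observe (w i)).val) :=
    isProbabilityMeasure_mixRoundLaw hK hH D (isDistr_frankWolfe E (1 / 2) _ h₀ T)
  exact Measure.pi.instIsProbabilityMeasure _

lemma interactionLaw_eq_compProd (hK : 0 < K) (hH : ∀ h ∈ H, Measurable h)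
    (D : Measure (X × Fin K)) [IsProbabilityMeasure D] (E : ERMOracle H) (h₀ : H)
    (N₁ N₂ T : ℕ) :
    interactionLaw D E (1 / 2) h₀ N₁ N₂ T =
      (Measure.pi fun _ : Fin N₁ => uniformRoundLaw D) ⊗ₘ
        secondPhaseKernel hH D E (1 / 2) h₀ N₁ N₂ T := by
  have := isProbabilityMeasure_uniformRoundLaw hK D
  have := isMarkovKernel_secondPhaseKernel hK hH D E h₀ N₁ N₂ T
  rw [Measure.compProd_eq_comp_prod, interactionLaw]
  congr 1
  funext w
  rw [Kernel.prod_apply, Kernel.id_apply, Measure.dirac_prod]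
  rfl

end Measurability

/-! ### The two phases succeed with high probability -/

section Phases

variable {X : Type*} [MeasurableSpace X] {K : ℕ} {H : Finset (X → Fin K)}

/-- The failure event of the first phase: too many rounds have positive feedback, or for some
sparse distribution the empirical inverse reward of a hypothesis is much smaller than a large
population value. -/
def phaseOneBad (D : Measure (X × Fin K)) (H : Finset (X → Fin K)) (m N : ℕ) :
    Set (Fin N → Round X K) :=
  {w | N * (2 / (K : ℝ)) ≤ ∑ i, onCorrect (fun _ => 1) (w i)} ∪
    ⋃ x : H × (Fin m → H), {w | 32 ≤ invReward D (empDistr x.2) x.1.1 ∧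
      ∑ i, onCorrect (invHit (empDistr x.2) x.1.1) (w i) ≤
        N * (invReward D (empDistr x.2) x.1.1 / (2 * K))}

lemma integrable_invHit (hK : 0 < K) (hH : ∀ h ∈ H, Measurable h) (D : Measure (X × Fin K))
    [IsProbabilityMeasure D] {p : H → ℝ} (hp : IsDistr p) {h : X → Fin K} (hh : Measurable h) :
    Integrable (invHit p h) D :=
  .of_bound (measurable_invHit hH p hh).aestronglyMeasurable (2 * K)
    (.of_forall (abs_invHit_le hK hp h))

/-- Outside the failure event, the distribution computed in the first phase has bounded inverse
reward along every hypothesis. The bound is transferred from the sample to the population through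
a random sparse approximation of the distribution. -/
lemma invReward_phaseOne_le (hK : 0 < K) (hH : ∀ h ∈ H, Measurable h) (D : Measure (X × Fin K))
    [IsProbabilityMeasure D] (E : ERMOracle H) (h₀ : H) {T N : ℕ} (hN : 0 < N)
    (hT : 256 * (K : ℝ) ^ 4 ≤ T) {w : Fin N → Round X K}
    (hw : w ∉ phaseOneBad D H (2 * K ^ 3) N) (h : H) :
    invReward D (phaseOne E (1 / 2) h₀ T fun i => observe (w i)).val h.1 ≤ 52 := by
  set m : ℕ := 2 * K ^ 3 with hm
  have hm0 : 0 < m := by positivity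
  have hK' : (0 : ℝ) < K := by exact_mod_cast hK
  have hN' : (0 : ℝ) < N := by exact_mod_cast hN
  have hmK : 2 * (K : ℝ) ^ 3 / m = 1 := by
    rw [hm]; push_cast; exact div_self (by positivity)
  set p : H → ℝ := (phaseOne E (1 / 2) h₀ T fun i => observe (w i)).val with hpdef
  have hp : IsDistr p := isDistr_frankWolfe E (1 / 2) _ h₀ T
  set W : (Fin m → H) → ℝ := fun ω => ∏ i, p (ω i) with hW
  have hW0 : ∀ ω, 0 ≤ W ω := fun ω => Finset.prod_nonneg fun i _ => hp.1 _
  have hW1 : ∑ ω, W ω = 1 := by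
    simp only [hW]; rw [← Fintype.sum_pow, hp.2, one_pow]
  simp only [phaseOneBad, Set.mem_union, Set.mem_iUnion, Set.mem_ofPred_eq, not_or, not_exists,
    not_and, not_le] at hw
  obtain ⟨hS, hdev⟩ := hw
  set c : ℝ := ∑ i, onCorrect (fun _ => 1) (w i) with hc
  have hup : ∀ z, ∑ ω, W ω * invHit (empDistr ω) h.1 z ≤ invHit p h.1 z + 1 := fun z => by
    have h1 := (sum_prod_mul_inv_mixProb hK hm0 hp z).2
    rw [hmK] at h1
    calc _ = hit h.1 z * ∑ ω, W ω * (mixProb (1 / 2) (empDistr ω) z.1 z.2)⁻¹ := by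
          rw [Finset.mul_sum]
          exact Finset.sum_congr rfl fun ω _ => by simp only [invHit]; ring
      _ ≤ hit h.1 z * ((mixProb (1 / 2) p z.1 z.2)⁻¹ + 1) :=
          mul_le_mul_of_nonneg_left h1 (hit_nonneg _ _)
      _ = invHit p h.1 z + hit h.1 z := by simp only [invHit]; ring
      _ ≤ _ := by linarith [hit_le_one h.1 z]
  have hlow : ∀ z, invHit p h.1 z ≤ ∑ ω, W ω * invHit (empDistr ω) h.1 z := fun z => by
    have h1 := (sum_prod_mul_inv_mixProb hK hm0 hp z).1
    calc _ = hit h.1 z * (mixProb (1 / 2) p z.1 z.2)⁻¹ := by simp only [invHit]; ring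
      _ ≤ hit h.1 z * ∑ ω, W ω * (mixProb (1 / 2) (empDistr ω) z.1 z.2)⁻¹ :=
          mul_le_mul_of_nonneg_left h1 (hit_nonneg _ _)
      _ = _ := by
          rw [Finset.mul_sum]
          exact Finset.sum_congr rfl fun ω _ => by simp only [invHit]; ring
  have hemp : ∑ i, onCorrect (invHit p h.1) (w i) ≤ 4 * c := by
    have := sum_hit_div_frankWolfe_le hK E (labeledSample fun i => observe (w i)) h₀ hT h
    rw [length_labeledSample] at this
    refine le_trans (le_of_eq ?_) this
    exact (sum_map_labeledSample w _).symm
  have hsamp : ∑ ω, W ω * ∑ i, onCorrect (invHit (empDistr ω) h.1) (w i) ≤ 5 * c := by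
    calc _ = ∑ i, ∑ ω, W ω * onCorrect (invHit (empDistr ω) h.1) (w i) := by
          simp only [Finset.mul_sum]
          rw [Finset.sum_comm]
      _ ≤ ∑ i, (onCorrect (invHit p h.1) (w i) + onCorrect (fun _ => 1) (w i)) := by
          refine Finset.sum_le_sum fun i _ => ?_
          unfold onCorrect
          split_ifs
          · exact hup _
          · simp
      _ ≤ 5 * c := by
          rw [Finset.sum_add_distrib]
          linarith
  have hsnn : ∀ ω : Fin m → H, 0 ≤ ∑ i, onCorrect (invHit (empDistr ω) h.1) (w i) := fun ω =>
    Finset.sum_nonneg fun i _ => by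
      unfold onCorrect
      split_ifs
      · exact invHit_nonneg hK (isDistr_empDistr hm0 ω) _ _
      · exact le_rfl
  have hpop : ∀ ω : Fin m → H, invReward D (empDistr ω) h.1 ≤
      32 + 2 * K / N * ∑ i, onCorrect (invHit (empDistr ω) h.1) (w i) := fun ω => by
    rcases lt_or_ge (invReward D (empDistr ω) h.1) 32 with h32 | h32
    · have := mul_nonneg (show 0 ≤ 2 * (K : ℝ) / N by positivity) (hsnn ω)
      linarith
    · have h1 := mul_le_mul_of_nonneg_left (hdev (h, ω) h32).le
        (show 0 ≤ 2 * (K : ℝ) / N by positivity)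
      have h2 : 2 * (K : ℝ) / N * (N * (invReward D (empDistr ω) h.1 / (2 * K))) =
          invReward D (empDistr ω) h.1 := by field_simp
      simp only [h2] at h1
      linarith
  calc invReward D p h.1 ≤ ∫ z, ∑ ω, W ω * invHit (empDistr ω) h.1 z ∂D :=
        integral_mono (integrable_invHit hK hH D hp (hH h.1 h.2))
          (integrable_finsetSum _ fun ω _ =>
            (integrable_invHit hK hH D (isDistr_empDistr hm0 ω) (hH h.1 h.2)).const_mul _) hlow
    _ = ∑ ω, W ω * invReward D (empDistr ω) h.1 := by
        rw [integral_finsetSum _ fun ω _ =>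
          (integrable_invHit hK hH D (isDistr_empDistr hm0 ω) (hH h.1 h.2)).const_mul _]
        simp only [integral_const_mul]
        rfl
    _ ≤ ∑ ω, W ω * (32 + 2 * K / N * ∑ i, onCorrect (invHit (empDistr ω) h.1) (w i)) :=
        Finset.sum_le_sum fun ω _ => mul_le_mul_of_nonneg_left (hpop ω) (hW0 ω)
    _ = 32 + 2 * K / N * ∑ ω, W ω * ∑ i, onCorrect (invHit (empDistr ω) h.1) (w i) := by
        simp only [mul_add, Finset.sum_add_distrib, ← Finset.sum_mul, hW1, one_mul]
        congr 1
        rw [Finset.mul_sum]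
        exact Finset.sum_congr rfl fun ω _ => by ring
    _ ≤ 32 + 2 * K / N * (5 * (N * (2 / K))) := by gcongr; linarith
    _ = 52 := by field_simp; norm_num

/-- Union bound for the first phase. -/
lemma pi_real_phaseOneBad_le (hK : 0 < K) (hH : ∀ h ∈ H, Measurable h) (D : Measure (X × Fin K))
    [IsProbabilityMeasure D] {m : ℕ} (hm : 0 < m) (N : ℕ) :
    (Measure.pi fun _ : Fin N => uniformRoundLaw D).real (phaseOneBad D H m N) ≤
      Real.exp (-(N * (1 / (4 * (K : ℝ))))) +
        (H.card : ℝ) ^ (m + 1) * Real.exp (-(N * (1 / (K : ℝ) ^ 2))) := by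
  have := isProbabilityMeasure_uniformRoundLaw hK D
  refine (measureReal_union_le _ _).trans
    (add_le_add (pi_real_two_mul_le_sum_onCorrect_one hK D N) ?_)
  refine (measureReal_iUnion_fintype_le _).trans ?_
  have hone : ∀ x : H × (Fin m → H), (Measure.pi fun _ : Fin N => uniformRoundLaw D).real
      {w | 32 ≤ invReward D (empDistr x.2) x.1.1 ∧
        ∑ i, onCorrect (invHit (empDistr x.2) x.1.1) (w i) ≤
          N * (invReward D (empDistr x.2) x.1.1 / (2 * K))} ≤
      Real.exp (-(N * (1 / (K : ℝ) ^ 2))) := fun x => by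
    by_cases h32 : 32 ≤ invReward D (empDistr x.2) x.1.1
    · simp only [h32, true_and]
      exact pi_real_sum_onCorrect_invHit_le hK hH D (isDistr_empDistr hm x.2)
        (hH x.1.1 x.1.2) h32 N
    · simp only [h32, false_and]
      simp [Real.exp_nonneg]
  refine (Finset.sum_le_sum fun x _ => hone x).trans (le_of_eq ?_)
  simp only [Finset.sum_const, Finset.card_univ, Fintype.card_prod, Fintype.card_fun,
    Fintype.card_coe, Fintype.card_fin, nsmul_eq_mul]
  push_cast
  ring

/-- Union bound for the second phase. -/
lemma pi_real_not_epsOptimal_le (hK : 0 < K) (hH : ∀ h ∈ H, Measurable h)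
    (D : Measure (X × Fin K)) [IsProbabilityMeasure D] (E : ERMOracle H) {p : H → ℝ}
    (hp : IsDistr p) {V ε : ℝ} (hV : 0 < V) (hF : ∀ h : H, invReward D p h.1 ≤ V) (hε : 0 < ε)
    (N : ℕ) :
    (Measure.pi fun _ : Fin N => mixRoundLaw D (1 / 2) p).real
      {w | ¬ EpsOptimal D H ε (E.run (phaseTwoData (1 / 2) p fun i => observe (w i))).1} ≤
      H.card * Real.exp (-(N * (ε ^ 2 / (4 * K * ε + 8 * V)))) := by
  have := isProbabilityMeasure_mixRoundLaw hK hH D hp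
  rcases H.eq_empty_or_nonempty with h0 | hne
  · subst h0
    exact absurd (E.run []).2 (Finset.notMem_empty _)
  obtain ⟨h', hh', hbest⟩ := H.exists_max_image (reward D) hne
  have hsub : {w : Fin N → Round X K |
      ¬ EpsOptimal D H ε (E.run (phaseTwoData (1 / 2) p fun i => observe (w i))).1} ⊆
      ⋃ h : H, {w | ε < reward D h' - reward D h.1 ∧
        ∑ i, onCorrect (invHit p h') (w i) ≤ ∑ i, onCorrect (invHit p h.1) (w i)} := by
    intro w hw
    simp only [EpsOptimal, Set.mem_ofPred_eq, not_forall, not_le, Set.mem_iUnion] at hw ⊢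
    obtain ⟨g, hg, hgap⟩ := hw
    exact ⟨_, by linarith [hbest g hg], sum_onCorrect_le_run hK E hp w ⟨h', hh'⟩⟩
  refine (measureReal_mono hsub).trans ((measureReal_iUnion_fintype_le _).trans ?_)
  have hone : ∀ h : H, (Measure.pi fun _ : Fin N => mixRoundLaw D (1 / 2) p).real
      {w | ε < reward D h' - reward D h.1 ∧
        ∑ i, onCorrect (invHit p h') (w i) ≤ ∑ i, onCorrect (invHit p h.1) (w i)} ≤
      Real.exp (-(N * (ε ^ 2 / (4 * K * ε + 8 * V)))) := fun h => by
    by_cases hgap : ε < reward D h' - reward D h.1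
    · simp only [hgap, true_and]
      exact pi_real_sum_le_sum_onCorrect hK hH D hp (hH h.1 h.2) (hH h' hh') hV (hF h)
        (hF ⟨h', hh'⟩) hε hgap N
    · simp only [hgap, false_and]
      simp [Real.exp_nonneg]
  refine (Finset.sum_le_sum fun x _ => hone x).trans (le_of_eq ?_)
  simp

/-- If the first phase fails with probability at most `a` and the second phase, after a successful
first phase, with probability at most `b`, then the algorithm fails with probability at most
`a + b`. -/
lemma interactionLaw_not_epsOptimal_le (hK : 0 < K) (hH : ∀ h ∈ H, Measurable h)
    (D : Measure (X × Fin K)) [IsProbabilityMeasure D] (E : ERMOracle H) (h₀ : H)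
    {N₁ N₂ T : ℕ} {ε a b : ℝ} (B : Set (Fin N₁ → Round X K))
    (ha : (Measure.pi fun _ : Fin N₁ => uniformRoundLaw D).real B ≤ a)
    (hb : ∀ w ∉ B, (Measure.pi fun _ : Fin N₂ => mixRoundLaw D (1 / 2)
        (phaseOne E (1 / 2) h₀ T fun i => observe (w i)).val).real
      {w₂ | ¬ EpsOptimal D H ε (E.run (phaseTwoData (1 / 2)
        (phaseOne E (1 / 2) h₀ T fun i => observe (w i)).val fun i => observe (w₂ i))).1} ≤ b) :
    interactionLaw D E (1 / 2) h₀ N₁ N₂ T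
      {w | ¬ EpsOptimal D H ε (runOn E (1 / 2) h₀ T w).val.1} ≤
        ENNReal.ofReal a + ENNReal.ofReal b := by
  have := isProbabilityMeasure_uniformRoundLaw hK D
  have := isMarkovKernel_secondPhaseKernel hK hH D E h₀ N₁ N₂ T
  set μ := Measure.pi fun _ : Fin N₁ => uniformRoundLaw D with hμ
  set κ := secondPhaseKernel hH D E (1 / 2) h₀ N₁ N₂ T with hκ
  have hmeas := measurableSet_runOn hH E (1 / 2) h₀ T N₁ N₂
    fun h => ¬ EpsOptimal D H ε h.1
  rw [interactionLaw_eq_compProd hK hH, Measure.compProd_apply hmeas]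
  calc _ ≤ ∫⁻ w, (B.indicator (fun _ => 1) w + ENNReal.ofReal b) ∂μ := by
        refine lintegral_mono fun w => ?_
        by_cases hw : w ∈ B
        · simp only [hw, Set.indicator_of_mem]
          exact prob_le_one.trans le_self_add
        · simp only [hw, not_false_eq_true, Set.indicator_of_notMem, zero_add]
          refine ENNReal.le_ofReal_iff_toReal_le (measure_ne_top _ _)
            (measureReal_nonneg.trans (hb w hw)) |>.mpr (hb w hw)
    _ = ∫⁻ w, B.indicator (fun _ => 1) w ∂μ + ENNReal.ofReal b := by
        rw [lintegral_add_right _ measurable_const]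
        simp
    _ ≤ μ B + ENNReal.ofReal b := by
        gcongr
        exact lintegral_indicator_one_le B
    _ ≤ _ := by
        gcongr
        exact ENNReal.le_ofReal_iff_toReal_le (measure_ne_top _ _)
            (measureReal_nonneg.trans ha) |>.mpr ha

end Phases

/-! ### The choice of the sample sizes -/

lemma mul_exp_neg_le {n δ x c : ℝ} (hn : 0 < n) (hδ : 0 < δ) (hc : 0 < c)
    (hx : Real.log n - Real.log δ + Real.log c ≤ x) : n * Real.exp (-x) ≤ δ / c := by
  have h1 : n = Real.exp (Real.log n) := (Real.exp_log hn).symm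
  have h2 : δ / c = Real.exp (Real.log δ - Real.log c) := by
    rw [Real.exp_sub, Real.exp_log hδ, Real.exp_log hc]
  rw [h2, h1, ← Real.exp_add, Real.exp_le_exp]
  linarith

/-- With `m = 2K³` the union bound of the first phase needs `N` of order `K⁵ log (n / δ)` only. The
assumption `2 ≤ n` absorbs the numerical constants, as `log (n / δ)` can be close to `0` for
`n = 1`. -/
lemma phaseOne_failure_le {K : ℕ} (hK : 0 < K) {n δ : ℝ} (hn : 2 ≤ n) (hδ : 0 < δ) (hδ1 : δ < 1)
    {N : ℕ} (hN : 12 * ((K : ℝ) ^ 7 * Real.log (n / δ)) ≤ N) :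
    Real.exp (-(N * (1 / (4 * (K : ℝ))))) +
      n ^ (2 * K ^ 3 + 1) * Real.exp (-(N * (1 / (K : ℝ) ^ 2))) ≤ δ / 2 := by
  have hK1 : (1 : ℝ) ≤ K := by exact_mod_cast hK
  have hlogδ : Real.log δ < 0 := Real.log_neg hδ hδ1
  have hlogn : Real.log 2 ≤ Real.log n := Real.log_le_log (by norm_num) hn
  have hlog2 : 0 < Real.log 2 := Real.log_pos (by norm_num)
  have hlog4 : Real.log 4 = 2 * Real.log 2 := by
    rw [show (4 : ℝ) = 2 ^ 2 by norm_num, Real.log_pow]; norm_num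
  set L := Real.log (n / δ) with hLdef
  have hL : L = Real.log n - Real.log δ := Real.log_div (by linarith) hδ.ne'
  have hL0 : 0 < L := by linarith
  have h7 : ∀ j ≤ 7, (K : ℝ) ^ j * L ≤ (K : ℝ) ^ 7 * L := fun j hj =>
    mul_le_mul_of_nonneg_right (pow_le_pow_right₀ hK1 hj) hL0.le
  have e1 : 1 * Real.exp (-(N * (1 / (4 * (K : ℝ))))) ≤ δ / 4 := by
    refine mul_exp_neg_le one_pos hδ (by norm_num) ?_
    have : 3 * L ≤ N * (1 / (4 * (K : ℝ))) := by
      rw [mul_one_div, le_div_iff₀ (by positivity)]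
      have := h7 1 (by norm_num)
      rw [pow_one] at this
      linarith
    rw [Real.log_one]
    linarith
  have e2 : n ^ (2 * K ^ 3 + 1) * Real.exp (-(N * (1 / (K : ℝ) ^ 2))) ≤ δ / 4 := by
    refine mul_exp_neg_le (by positivity) hδ (by norm_num) ?_
    have h3 : (1 : ℝ) ≤ (K : ℝ) ^ 3 := one_le_pow₀ hK1
    have : 6 * (K : ℝ) ^ 3 * L ≤ N * (1 / (K : ℝ) ^ 2) := by
      rw [mul_one_div, le_div_iff₀ (by positivity)]
      have h5 := h7 5 (by norm_num)
      have h6 : 6 * (K : ℝ) ^ 3 * L * (K : ℝ) ^ 2 = 6 * ((K : ℝ) ^ 5 * L) := by ring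
      have h8 : 0 ≤ (K : ℝ) ^ 7 * L := by positivity
      linarith
    rw [Real.log_pow]
    push_cast
    have h9 : 2 * (K : ℝ) ^ 3 * Real.log n ≤ 2 * (K : ℝ) ^ 3 * L :=
      mul_le_mul_of_nonneg_left (by linarith) (by positivity)
    have h10 : L ≤ (K : ℝ) ^ 3 * L := le_mul_of_one_le_left hL0.le h3
    linarith
  linarith

lemma phaseTwo_failure_le {K : ℕ} {n δ ε : ℝ} (hn : 2 ≤ n) (hδ : 0 < δ)
    (hδ1 : δ < 1) (hε : 0 < ε) {N : ℕ}
    (hN : 832 * ((K / ε + 1 / ε ^ 2) * Real.log (n / δ)) ≤ N) :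
    n * Real.exp (-(N * (ε ^ 2 / (4 * K * ε + 8 * 52)))) ≤ δ / 2 := by
  have hlogδ : Real.log δ < 0 := Real.log_neg hδ hδ1
  have hlogn : Real.log 2 ≤ Real.log n := Real.log_le_log (by norm_num) hn
  have hlog2 : 0 < Real.log 2 := Real.log_pos (by norm_num)
  set L := Real.log (n / δ) with hLdef
  have hL : L = Real.log n - Real.log δ := Real.log_div (by linarith) hδ.ne'
  have hL0 : 0 < L := by linarith
  refine mul_exp_neg_le (by linarith) hδ (by norm_num) ?_
  have : 2 * L ≤ N * (ε ^ 2 / (4 * K * ε + 8 * 52)) := by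
    rw [← mul_div_assoc, le_div_iff₀ (by positivity)]
    have h1 := mul_le_mul_of_nonneg_right hN (sq_nonneg ε)
    have h2 : 832 * ((K / ε + 1 / ε ^ 2) * L) * ε ^ 2 = 832 * ((K * ε + 1) * L) := by
      field_simp
    have h3 : 0 ≤ (K : ℝ) * ε * L := by positivity
    rw [h2] at h1
    linarith
  linarith

/-- The success probability of the algorithm. -/
lemma le_interactionLaw_epsOptimal {X : Type*} [MeasurableSpace X] {K : ℕ}
    {H : Finset (X → Fin K)} (hK : 0 < K) (hH : ∀ h ∈ H, Measurable h)
    (D : Measure (X × Fin K)) [IsProbabilityMeasure D] (E : ERMOracle H) (h₀ : H) {ε δ : ℝ}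
    (hε : 0 < ε) (hδ : 0 < δ) (hδ1 : δ < 1) {N₁ N₂ T : ℕ}
    (hN₁ : 12 * ((K : ℝ) ^ 7 * Real.log (H.card / δ)) ≤ N₁)
    (hN₂ : 832 * ((K / ε + 1 / ε ^ 2) * Real.log (H.card / δ)) ≤ N₂)
    (hT : 256 * (K : ℝ) ^ 4 ≤ T) :
    ENNReal.ofReal (1 - δ) ≤ interactionLaw D E (1 / 2) h₀ N₁ N₂ T
      {w | EpsOptimal D H ε (runOn E (1 / 2) h₀ T w).val.1} := by
  have := isProbabilityMeasure_uniformRoundLaw hK D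
  have := isMarkovKernel_secondPhaseKernel hK hH D E h₀ N₁ N₂ T
  have hprob : IsProbabilityMeasure (interactionLaw D E (1 / 2) h₀ N₁ N₂ T) := by
    rw [interactionLaw_eq_compProd hK hH]
    infer_instance
  have hmeas := measurableSet_runOn hH E (1 / 2) h₀ T N₁ N₂ fun h => ¬ EpsOptimal D H ε h.1
  have hbad : interactionLaw D E (1 / 2) h₀ N₁ N₂ T
      {w | ¬ EpsOptimal D H ε (runOn E (1 / 2) h₀ T w).val.1} ≤ ENNReal.ofReal δ := by
    rcases Nat.lt_or_ge 1 H.card with hcard | hcard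
    · have hn : (2 : ℝ) ≤ H.card := by exact_mod_cast hcard
      have hK' : (0 : ℝ) < K := by exact_mod_cast hK
      have hL : 0 < Real.log (H.card / δ) :=
        Real.log_pos (by rw [lt_div_iff₀ hδ]; linarith)
      have hN₁0 : 0 < N₁ := by
        have : (0 : ℝ) < N₁ := lt_of_lt_of_le (by positivity) hN₁
        exact_mod_cast this
      refine (interactionLaw_not_epsOptimal_le hK hH D E h₀ (a := δ / 2) (b := δ / 2)
        (phaseOneBad D H (2 * K ^ 3) N₁) ?_ fun w hw => ?_).trans (le_of_eq ?_)
      · exact (pi_real_phaseOneBad_le hK hH D (by positivity) N₁).trans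
          (phaseOne_failure_le hK hn hδ hδ1 hN₁)
      · exact (pi_real_not_epsOptimal_le hK hH D E (isDistr_frankWolfe E (1 / 2) _ h₀ T)
          (by norm_num) (invReward_phaseOne_le hK hH D E h₀ hN₁0 hT hw) hε N₂).trans
          (phaseTwo_failure_le hn hδ hδ1 hε hN₂)
      · rw [← ENNReal.ofReal_add (by positivity) (by positivity), add_halves]
    · -- a class with a single hypothesis
      have hall : ∀ h : H, EpsOptimal D H ε h.1 := fun h g hg => by
        rw [Finset.card_le_one.mp hcard g hg h.1 h.2, sub_self]
        exact hε.le
      simp [hall]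
  have hcompl : {w : (Fin N₁ → Round X K) × (Fin N₂ → Round X K) |
      EpsOptimal D H ε (runOn E (1 / 2) h₀ T w).val.1} =
      {w | ¬ EpsOptimal D H ε (runOn E (1 / 2) h₀ T w).val.1}ᶜ := by
    ext w
    simp
  rw [hcompl, prob_compl_eq_one_sub hmeas, ENNReal.ofReal_sub _ hδ.le, ENNReal.ofReal_one]
  exact tsub_le_tsub_left hbad 1

end BanditPAC

theorem mainTheorem2 :
    ∃ c₁ c₂ c₃ : ℝ, 0 < c₁ ∧ 0 < c₂ ∧ 0 < c₃ ∧
    ∀ C₁ C₂ C₃ : ℝ, ∃ A B : ℝ, 0 < A ∧ 0 < B ∧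
    ∀ (X : Type*) [MeasurableSpace X] (K : ℕ) (D : Measure (X × Fin K)) [IsProbabilityMeasure D]
      (H : Finset (X → Fin K)) (_ : ∀ h ∈ H, Measurable h) (E : ERMOracle H) (h₀ : H)
      (ε δ : ℝ) (_ : 0 < ε) (_ : 0 < δ) (_ : δ < 1) (N₁ N₂ T : ℕ)
      (_ : c₁ * ((K : ℝ) ^ 7 * Real.log (H.card / δ)) ≤ N₁)
      (_ : c₂ * ((K / ε + 1 / ε ^ 2) * Real.log (H.card / δ)) ≤ N₂)
      (_ : c₃ * (K : ℝ) ^ 4 ≤ T),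
      ENNReal.ofReal (1 - δ) ≤ interactionLaw D E (1 / 2) h₀ N₁ N₂ T
          {w | EpsOptimal D H ε (runOn E (1 / 2) h₀ T w).val.1} ∧
      ((N₁ : ℝ) ≤ C₁ * ((K : ℝ) ^ 7 * Real.log (H.card / δ)) →
        (N₂ : ℝ) ≤ C₂ * ((K / ε + 1 / ε ^ 2) * Real.log (H.card / δ)) →
        ((N₁ + N₂ : ℕ) : ℝ) ≤ A * (((K : ℝ) ^ 7 + 1 / ε ^ 2) * Real.log (H.card / δ))) ∧
      (∀ w : (Fin N₁ → Round X K) × (Fin N₂ → Round X K),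
        (runOn E (1 / 2) h₀ T w).calls = T + 1) ∧
      ((T : ℝ) ≤ C₃ * (K : ℝ) ^ 4 → ((T + 1 : ℕ) : ℝ) ≤ B * (K : ℝ) ^ 4) := by
  refine ⟨12, 832, 256, by norm_num, by norm_num, by norm_num, fun C₁ C₂ C₃ =>
    ⟨|C₁| + 2 * |C₂| + 1, |C₃| + 1, by positivity, by positivity, ?_⟩⟩
  intro X _ K D _ H hH E h₀ ε δ hε hδ hδ1 N₁ N₂ T hN₁ hN₂ hT
  -- there is no probability measure on `X × Fin 0`
  have hK : 0 < K := by
    obtain ⟨z⟩ := nonempty_of_isProbabilityMeasure D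
    exact z.2.pos
  have hK1 : (1 : ℝ) ≤ K := by exact_mod_cast hK
  refine ⟨le_interactionLaw_epsOptimal hK hH D E h₀ hε hδ hδ1 hN₁ hN₂ hT, ?_,
    runOn_calls E (1 / 2) h₀ T, ?_⟩
  · intro h1 h2
    have hcard : (1 : ℝ) ≤ H.card := by exact_mod_cast Finset.card_pos.mpr ⟨_, h₀.2⟩
    have hL : 0 ≤ Real.log (H.card / δ) :=
      Real.log_nonneg (by rw [le_div_iff₀ hδ]; linarith)
    set L := Real.log (H.card / δ)
    -- AM-GM: `K / ε ≤ K ^ 2 + 1 / ε ^ 2`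
    have hKε : K / ε ≤ (K : ℝ) ^ 7 + 1 / ε ^ 2 := by
      have h7 : (K : ℝ) ^ 2 ≤ (K : ℝ) ^ 7 := pow_le_pow_right₀ hK1 (by norm_num)
      have e1 : (K : ℝ) / ε = K * (1 / ε) := by ring
      have e2 : 1 / ε ^ 2 = (1 / ε) ^ 2 := by rw [div_pow, one_pow]
      rw [e1, e2]
      nlinarith [sq_nonneg ((K : ℝ) - 1 / ε), sq_nonneg (K : ℝ), sq_nonneg (1 / ε)]
    have hε2 : 0 ≤ 1 / ε ^ 2 := by positivity
    have hK7 : 0 ≤ (K : ℝ) ^ 7 := by positivity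
    have a1 : C₁ * ((K : ℝ) ^ 7 * L) ≤ |C₁| * (((K : ℝ) ^ 7 + 1 / ε ^ 2) * L) :=
      mul_le_mul (le_abs_self _) (mul_le_mul_of_nonneg_right (by linarith) hL) (by positivity)
        (abs_nonneg _)
    have a2 : C₂ * ((K / ε + 1 / ε ^ 2) * L) ≤
        |C₂| * (2 * ((K : ℝ) ^ 7 + 1 / ε ^ 2) * L) :=
      mul_le_mul (le_abs_self _) (mul_le_mul_of_nonneg_right (by linarith) hL) (by positivity)
        (abs_nonneg _)
    have a3 : 0 ≤ ((K : ℝ) ^ 7 + 1 / ε ^ 2) * L := by positivity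
    push_cast
    linarith
  · intro h
    have h4 : (1 : ℝ) ≤ (K : ℝ) ^ 4 := one_le_pow₀ hK1
    have h5 : C₃ * (K : ℝ) ^ 4 ≤ |C₃| * (K : ℝ) ^ 4 :=
      mul_le_mul_of_nonneg_right (le_abs_self _) (by positivity)
    push_cast
    linarith
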